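/- **Theorem 1.** Let $\lambda_1,\lambda_2,\mu>0$, $T\in\mathbb R$ and let $B\ge\lambda_1+\lambda_2+\mu$ be finite. The state $(i,j,t)\in\mathbb N_0\times\mathbb N_0\times[0,\infty)$ gives the number $i$ of queries, the number $j$ of reports and the age $t$ of the stored data. A policy is a map $\pi:(i,j,t)\mapsto\pi(i,j,t)\in\{\mathrm{DB},\mathrm{WSN}\}$ that is left-continuous in $t$; it gives the action taken when a query arrives and finds the system in state $(i,j,t)$. *Rates.* When the state just before a transition is $(i,j,t)$ and $d=\pi(i,j,t)$, the transitions are: to $(i+1,j,t)$ at rate $\lambda_1$ if $d=\mathrm{WSN}$ (assignment to the WSN); to $(i,j,t)$ at rate $\lambda_1$ if $d=\mathrm{DB}$ (assignment to the DB); to $(i,j+1,t)$ at rate $\lambda_2$ (report arrival); to $(i-1,j,t)$ at rate $\mu\frac{i}{i+j}$ if $i>0$ (query completion); to $(i,j-1,0)$ at rate $\mu\frac{j}{i+j}$ if $j>0$ (report completion). The total rate is $\Lambda(i,j)=\lambda_1+\lambda_2+\mu\mathbf 1_{\{i+j>0\}}$. Between transitions $i$ and $j$ are constant and the age grows linearly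 with slope $1$. *Original process (continuous-time MDP with drift).* After a transition to $(i,j,\cdot)$, the next transition occurs after an $\mathrm{Exp}(\Lambda(i,j))$ time, and it is of each of the above kinds with probability its rate divided by $\Lambda(i,j)$, where $d$ is evaluated at the state just before the transition. *Exponentially uniformized process.* Transition epochs are separated by independent $\mathrm{Exp}(B)$ times, and at an epoch each of the above kinds of transition takes place with probability its rate divided by $B$, where again $d$ is evaluated at the state just before the epoch; with the remaining probability $1-\Lambda(i,j)/B$ there is a dummy transition that leaves the state unchanged. *Costs.* In state $(i,j,t)$ a cost is incurred at rate $i$, and at each assignment to the DB an instantaneous cost $(t-T)^+$. Let $C_h$ be the total cost incurred in $[0,h]$. The average cost is $\limsup_{h\to\infty}\mathbb E[C_h]/h$. Then, for every policy $\pi$ and every initial state, the two processes $(X_h)_{h\ge 0}$ of states in continuous time are stochastically equivalent, that is, they have the same law (the same finite-dimensional distributions); more precisely, the processes formed by the state at time $h$, the numbers of queries assigned to the DB and to the WSN up to time $h$, and $C_h$ have jointly the same law. Consequently, for every policy and every initial state, the two processes have the same expected cost $\mathbb E[C_h]$ over each finite horizon $h$ and the same average cost, and, for every initial state, the policies that are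 optimal (among all such policies) for the finite-horizon expected cost, for each $h$, and for the average cost are the same for the two processes. -/

import Mathlib

open MeasureTheory ProbabilityTheory
open scoped NNReal ENNReal

namespace QueryMDP

noncomputable section

/-- The two actions of the controller upon a query arrival. -/
inductive Action
  | DB
  | WSN
  deriving DecidableEq

instance : Fintype Action := ⟨{.DB, .WSN}, by intro a; cases a <;> simp⟩

instance : TopologicalSpace Action := ⊥
instance : DiscreteTopology Action := ⟨rfl⟩
instance : MeasurableSpace Action := ⊤
instance : DiscreteMeasurableSpace Action := ⟨fun _ => trivial⟩

/-- A state `(i, j, t)`: `i` queries, `j` reports, age `t`. -/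
abbrev State := ℕ × ℕ × ℝ≥0

/-- A (stationary, deterministic) policy, left-continuous in the age component. -/
structure Policy where
  /-- the action taken when a query arrives and finds the system in the given state -/
  act : State → Action
  leftCont : ∀ (i j : ℕ) (t : ℝ≥0),
    ContinuousWithinAt (fun u : ℝ≥0 => act (i, j, u)) (Set.Iic t) t

/-- The parameters of the model: arrival rates of queries and reports, the service rate and the
validity tolerance. -/
structure Model where
  lam1 : ℝ
  lam2 : ℝ
  mu : ℝ
  tol : ℝ
  lam1_pos : 0 < lam1
  lam2_pos : 0 < lam2
  mu_pos : 0 < mu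

/-- The kinds of transitions; `dummy` is the dummy self-transition of the uniformized process. -/
inductive Transition
  | wsnAssign
  | dbAssign
  | reportArrival
  | queryCompletion
  | reportCompletion
  | dummy
  deriving DecidableEq

instance : Fintype Transition := ⟨{.wsnAssign, .dbAssign, .reportArrival, .queryCompletion,
  .reportCompletion, .dummy}, by intro a; cases a <;> simp⟩

instance : MeasurableSpace Transition := ⊤
instance : DiscreteMeasurableSpace Transition := ⟨fun _ => trivial⟩

/-- The state after a transition, given the state just before it. -/
def Transition.apply : Transition → State → State
  | .wsnAssign, (i, j, t) => (i + 1, j, t)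
  | .dbAssign, (i, j, t) => (i, j, t)
  | .reportArrival, (i, j, t) => (i, j + 1, t)
  | .queryCompletion, (i, j, t) => (i - 1, j, t)
  | .reportCompletion, (i, j, _) => (i, j - 1, 0)
  | .dummy, (i, j, t) => (i, j, t)

/-- The transition rates `q^d` with `i` queries and `j` reports present (they do not depend on the
age). The rate of a completion is `0` when no job of that type is present. -/
def Model.rate (M : Model) (i j : ℕ) (d : Action) : Transition → ℝ
  | .wsnAssign => if d = Action.WSN then M.lam1 else 0
  | .dbAssign => if d = Action.DB then M.lam1 else 0
  | .reportArrival => M.lam2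
  | .queryCompletion => M.mu * ((i : ℝ) / ((i : ℝ) + (j : ℝ)))
  | .reportCompletion => M.mu * ((j : ℝ) / ((i : ℝ) + (j : ℝ)))
  | .dummy => 0

/-- The total transition rate. -/
def Model.totalRate (M : Model) (i j : ℕ) : ℝ :=
  M.lam1 + M.lam2 + if 0 < i + j then M.mu else 0

/-- The one-step probabilities of the uniformized process: `q^d / B` for the genuine transitions,
and the remaining mass for the dummy transition. -/
def Model.unifProb (M : Model) (B : ℝ) (i j : ℕ) (d : Action) : Transition → ℝ
  | .dummy => 1 - M.totalRate i j / B
  | a => M.rate i j d a / B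

lemma Model.totalRate_pos (M : Model) (i j : ℕ) : 0 < M.totalRate i j := by
  have := M.lam1_pos
  have := M.lam2_pos
  have := M.mu_pos
  unfold totalRate
  split_ifs <;> linarith

lemma Model.totalRate_le (M : Model) (i j : ℕ) : M.totalRate i j ≤ M.lam1 + M.lam2 + M.mu := by
  have := M.mu_pos
  unfold totalRate
  split_ifs <;> linarith

lemma Model.rate_nonneg (M : Model) (i j : ℕ) (d : Action) (a : Transition) :
    0 ≤ M.rate i j d a := by
  have h1 := M.lam1_pos.le
  have h2 := M.lam2_pos.le
  have h3 := M.mu_pos.le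
  cases a <;> cases d <;> simp only [rate] <;> positivity

lemma sum_transition (f : Transition → ℝ) :
    ∑ a, f a = f .wsnAssign + f .dbAssign + f .reportArrival + f .queryCompletion
      + f .reportCompletion + f .dummy := by
  have h : (Finset.univ : Finset Transition) = {.wsnAssign, .dbAssign, .reportArrival,
    .queryCompletion, .reportCompletion, .dummy} := rfl
  rw [h]
  simp
  ring

lemma Model.sum_rate (M : Model) (i j : ℕ) (d : Action) :
    ∑ a, M.rate i j d a = M.totalRate i j := by
  have hphi : M.mu * ((i : ℝ) / ((i : ℝ) + (j : ℝ))) + M.mu * ((j : ℝ) / ((i : ℝ) + (j : ℝ)))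
      = if 0 < i + j then M.mu else 0 := by
    split_ifs with h
    · have : (0 : ℝ) < (i : ℝ) + (j : ℝ) := by exact_mod_cast h
      field_simp
    · have hi : i = 0 := by omega
      have hj : j = 0 := by omega
      simp [hi, hj]
  rw [sum_transition, totalRate, ← hphi]
  cases d <;> simp [rate] <;> ring

/-- The law of the next transition of the original process, given that a transition occurs:
each transition has probability proportional to its rate. -/
def Model.jumpPMF (M : Model) (q : ℕ × ℕ × Action) : PMF Transition :=
  PMF.ofFintype (fun a => ENNReal.ofReal (M.rate q.1 q.2.1 q.2.2 a / M.totalRate q.1 q.2.1)) (by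
    rw [← ENNReal.ofReal_sum_of_nonneg
      (fun a _ => div_nonneg (M.rate_nonneg _ _ _ a) (M.totalRate_pos _ _).le),
      ← Finset.sum_div, M.sum_rate, div_self (M.totalRate_pos _ _).ne', ENNReal.ofReal_one])

lemma Model.B_pos (M : Model) {B : ℝ} (hB : M.lam1 + M.lam2 + M.mu ≤ B) : 0 < B := by
  have := M.lam1_pos
  have := M.lam2_pos
  have := M.mu_pos
  linarith

lemma Model.unifProb_nonneg (M : Model) {B : ℝ} (hB : M.lam1 + M.lam2 + M.mu ≤ B) (i j : ℕ)
    (d : Action) (a : Transition) : 0 ≤ M.unifProb B i j d a := by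
  have hB0 := M.B_pos hB
  cases a
  case dummy =>
    have h : M.totalRate i j / B ≤ 1 := (div_le_one hB0).2 ((M.totalRate_le i j).trans hB)
    simp only [unifProb]
    linarith
  all_goals exact div_nonneg (M.rate_nonneg _ _ _ _) hB0.le

lemma Model.sum_unifProb (M : Model) (B : ℝ) (i j : ℕ) (d : Action) :
    ∑ a, M.unifProb B i j d a = 1 := by
  have h := M.sum_rate i j d
  rw [sum_transition] at h ⊢
  simp only [unifProb, ← h, rate]
  ring

/-- The law of the transition of the uniformized process at a transition epoch. -/
def Model.unifPMF (M : Model) (B : ℝ) (hB : M.lam1 + M.lam2 + M.mu ≤ B) (q : ℕ × ℕ × Action) :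
    PMF Transition :=
  PMF.ofFintype (fun a => ENNReal.ofReal (M.unifProb B q.1 q.2.1 q.2.2 a)) (by
    rw [← ENNReal.ofReal_sum_of_nonneg (fun a _ => M.unifProb_nonneg hB _ _ _ a),
      M.sum_unifProb, ENNReal.ofReal_one])

/-- The record of a transition: its epoch, its kind, and the state just after it. -/
abbrev Record := ℝ≥0 × Transition × State

/-- The deterministic linear drift: the state `(i, j, t)` after `s` time units without
transition. -/
def drift (x : State) (s : ℝ≥0) : State := (x.1, x.2.1, x.2.2 + s)

lemma measurable_drift : Measurable fun z : State × ℝ≥0 => drift z.1 z.2 := by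
  unfold drift
  fun_prop

lemma Transition.measurable_apply :
    Measurable fun z : Transition × State => Transition.apply z.1 z.2 := by
  refine measurable_from_prod_countable_right fun a => ?_
  cases a
  · exact (measurable_of_countable (fun i : ℕ => i + 1)).comp measurable_fst |>.prodMk measurable_snd
  · exact measurable_id
  · exact measurable_fst.prodMk (((measurable_of_countable (fun i : ℕ => i + 1)).comp
      (measurable_fst.comp measurable_snd)).prodMk (measurable_snd.comp measurable_snd))
  · exact (measurable_of_countable (fun i : ℕ => i - 1)).comp measurable_fst |>.prodMk measurable_snd
  · exact measurable_fst.prodMk (((measurable_of_countable (fun i : ℕ => i - 1)).comp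
      (measurable_fst.comp measurable_snd)).prodMk measurable_const)
  · exact measurable_id

/-- Left-continuity in the age makes a policy Borel measurable. -/
lemma Policy.measurable_act (p : Policy) : Measurable p.act := by
  refine measurable_from_prod_countable_right fun i => measurable_from_prod_countable_right fun j => ?_
  let f : ℝ≥0 → Action := fun u => p.act (i, j, u)
  let g : ℕ → ℝ≥0 → ℝ≥0 := fun n u => (⌊u * ((n : ℝ≥0) + 1)⌋₊ : ℝ≥0) / ((n : ℝ≥0) + 1)
  have hg_le : ∀ n u, g n u ≤ u := fun n u =>
    div_le_of_le_mul₀ (by positivity) (by positivity) (Nat.floor_le (by positivity))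
  have hg_tendsto : ∀ u, Filter.Tendsto (fun n => g n u) Filter.atTop (nhds u) := by
    intro u
    have h1 := (tendsto_nat_floor_mul_div_atTop (R := ℝ) u.coe_nonneg).comp
      (Filter.tendsto_atTop_add_const_right Filter.atTop (1 : ℝ) tendsto_natCast_atTop_atTop)
    rw [← NNReal.tendsto_coe]
    refine h1.congr fun n => ?_
    simp only [g, Function.comp, NNReal.coe_div, NNReal.coe_natCast, NNReal.coe_add,
      NNReal.coe_one]
    congr 2
  change Measurable f
  refine measurable_of_tendsto_metrizable (f := fun n u => f (g n u)) (fun n => ?_) ?_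
  · have h2 : Measurable fun u : ℝ≥0 => ⌊u * ((n : ℝ≥0) + 1)⌋₊ :=
      Nat.measurable_floor.comp (measurable_id.mul_const _)
    exact (measurable_of_countable
      (fun k : ℕ => f ((k : ℝ≥0) / ((n : ℝ≥0) + 1)))).comp h2
  · rw [tendsto_pi_nhds]
    intro u
    refine (p.leftCont i j u).tendsto.comp (tendsto_nhdsWithin_iff.2 ⟨hg_tendsto u, ?_⟩)
    exact Filter.Eventually.of_forall fun n => hg_le n u

/-- The time until the next transition epoch: exponential with parameter `r (i, j)`. -/
def holdingKernel (r : ℕ × ℕ → ℝ) : Kernel State ℝ≥0 :=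
  (Kernel.ofFunOfCountable fun q : ℕ × ℕ => (expMeasure (r q)).map Real.toNNReal).comap
    (fun x : State => (x.1, x.2.1)) (by fun_prop)

/-- The kind of the transition that takes place `s` time units after the last epoch, at which the
state was `x`: it has law `P (i, j, d)`, where `d` is the action that the policy prescribes
in the state `drift x s` in which the transition finds the system. -/
def transitionKernel (P : ℕ × ℕ × Action → PMF Transition) (p : Policy) :
    Kernel (State × ℝ≥0) Transition :=
  (Kernel.ofFunOfCountable fun q : ℕ × ℕ × Action => (P q).toMeasure).comap
    (fun z : State × ℝ≥0 => (z.1.1, z.1.2.1, p.act (drift z.1 z.2)))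
    (by
      have := p.measurable_act.comp measurable_drift
      fun_prop)

/-- From one transition epoch to the next. -/
def stepKernel (r : ℕ × ℕ → ℝ) (P : ℕ × ℕ × Action → PMF Transition) (p : Policy) :
    Kernel Record Record :=
  (Kernel.id ×ₖ
      ((holdingKernel r ⊗ₖ transitionKernel P p).comap (fun w : Record => w.2.2)
        (by fun_prop))).map
    (fun z : Record × (ℝ≥0 × Transition) =>
      (z.1.1 + z.2.1, z.2.2, Transition.apply z.2.2 (drift z.1.2.2 z.2.1)))

instance isMarkovKernel_transitionKernel (P : ℕ × ℕ × Action → PMF Transition) (p : Policy) :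
    IsMarkovKernel (transitionKernel P p) :=
  ⟨fun z => by
    rw [transitionKernel, Kernel.comap_apply]
    exact PMF.toMeasure.isProbabilityMeasure _⟩

lemma isMarkovKernel_holdingKernel {r : ℕ × ℕ → ℝ} (hr : ∀ q, 0 < r q) :
    IsMarkovKernel (holdingKernel r) :=
  ⟨fun x => by
    rw [holdingKernel, Kernel.comap_apply]
    have := isProbabilityMeasure_expMeasure (hr (x.1, x.2.1))
    exact Measure.isProbabilityMeasure_map measurable_real_toNNReal.aemeasurable⟩

lemma measurable_stepMap : Measurable (fun z : Record × (ℝ≥0 × Transition) =>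
    ((z.1.1 + z.2.1, z.2.2, Transition.apply z.2.2 (drift z.1.2.2 z.2.1)) : Record)) := by
  have h1 : Measurable fun z : Record × (ℝ≥0 × Transition) => drift z.1.2.2 z.2.1 :=
    measurable_drift.comp
      ((measurable_snd.comp (measurable_snd.comp measurable_fst)).prodMk
        (measurable_fst.comp measurable_snd))
  have h2 : Measurable fun z : Record × (ℝ≥0 × Transition) =>
      Transition.apply z.2.2 (drift z.1.2.2 z.2.1) :=
    Transition.measurable_apply.comp ((measurable_snd.comp measurable_snd).prodMk h1)
  fun_prop

lemma isMarkovKernel_stepKernel {r : ℕ × ℕ → ℝ} (hr : ∀ q, 0 < r q)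
    (P : ℕ × ℕ × Action → PMF Transition) (p : Policy) : IsMarkovKernel (stepKernel r P p) := by
  have := isMarkovKernel_holdingKernel hr
  exact Kernel.IsMarkovKernel.map _ measurable_stepMap

/-- The law of the sequence of records when the process starts in the state `x` at time `0`, for
a given law of the transition from one epoch to the next. The record number `0` holds the initial
state and is no transition. -/
def recordLaw (K : Kernel Record Record) (hK : IsMarkovKernel K) (x : State) :
    Measure (ℕ → Record) :=
  have := hK
  Kernel.trajMeasure (X := fun _ => Record)
    (Measure.dirac ((0, Transition.dummy, x) : Record))
    (fun n => K.comap (fun h : (i : Finset.Iic n) → Record => h ⟨n, by simp⟩)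
      (measurable_pi_apply _))

/-- The original continuous-time Markov decision process with drift under the policy `p`: between
transitions the age grows linearly, a transition occurs after an exponential time with the total
rate as its parameter, and it is of each kind with probability proportional to its rate. -/
def Model.originalLaw (M : Model) (p : Policy) (x : State) : Measure (ℕ → Record) :=
  recordLaw (stepKernel (fun q => M.totalRate q.1 q.2) M.jumpPMF p)
    (isMarkovKernel_stepKernel (fun q => M.totalRate_pos q.1 q.2) _ _) x

/-- The exponentially uniformized Markov decision process under the policy `p`: the times between
transition epochs are exponential with parameter `B`, with dummy transitions. -/
def Model.uniformizedLaw (M : Model) (B : ℝ) (hB : M.lam1 + M.lam2 + M.mu ≤ B) (p : Policy)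
    (x : State) : Measure (ℕ → Record) :=
  recordLaw (stepKernel (fun _ => B) (M.unifPMF B hB) p)
    (isMarkovKernel_stepKernel (fun _ => M.B_pos hB) _ _) x

/-- The index of the last transition epoch up to time `t`. (If infinitely many epochs accumulate
before `t`, which has probability `0`, this is `0`.) -/
def lastEpoch (w : ℕ → Record) (t : ℝ≥0) : ℕ := sSup {n : ℕ | (w n).1 ≤ t}

/-- The state at time `t`. -/
def stateAt (w : ℕ → Record) (t : ℝ≥0) : State :=
  drift (w (lastEpoch w t)).2.2 (t - (w (lastEpoch w t)).1)

open Classical in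
/-- The number of transitions of the given kind up to time `t`. -/
def countUpTo (w : ℕ → Record) (a : Transition) (t : ℝ≥0) : ℝ≥0∞ :=
  ∑' n : ℕ, if (w n).1 ≤ t ∧ (w n).2.1 = a then 1 else 0

/-- The number of queries that up to time `t` have been assigned by the given action. -/
def assignedUpTo (w : ℕ → Record) (t : ℝ≥0) : Action → ℝ≥0∞
  | .DB => countUpTo w .dbAssign t
  | .WSN => countUpTo w .wsnAssign t

open Classical in
/-- The cost incurred up to time `t`: cost rate `i` while `i` queries are present, and an
instantaneous cost `(age - tol)⁺` at each assignment to the database (which leaves the age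
unchanged). -/
def Model.costUpTo (M : Model) (w : ℕ → Record) (t : ℝ≥0) : ℝ≥0∞ :=
  (∫⁻ u in Set.Icc (0 : ℝ) (t : ℝ), ((stateAt w u.toNNReal).1 : ℝ≥0∞)) +
    ∑' n : ℕ, if (w n).1 ≤ t ∧ (w n).2.1 = Transition.dbAssign then
      ENNReal.ofReal (((w n).2.2.2.2 : ℝ) - M.tol) else 0

/-- The expected cost up to time `h`, under a law of the sequence of records. -/
def Model.expectedCost (M : Model) (ν : Measure (ℕ → Record)) (h : ℝ≥0) : ℝ≥0∞ :=
  ∫⁻ w, M.costUpTo w h ∂ν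

/-- The long-run average expected cost. -/
def Model.averageCost (M : Model) (ν : Measure (ℕ → Record)) : ℝ≥0∞ :=
  Filter.limsup (fun h : ℝ≥0 => M.expectedCost ν h / (h : ℝ≥0∞)) Filter.atTop

/-- The policies that minimize the cost `V`. -/
def optimalPolicies (V : Policy → ℝ≥0∞) : Set Policy := {p | ∀ p', V p ≤ V p'}

end

end QueryMDP

namespace QueryMDP

/-! Uniformization inserts epochs at which the state merely drifts on, so deleting the dummy records
from the uniformized chain should return the original chain. The analytic reason is memorylessness:
an exponential clock of rate `L ≤ B` is a clock of rate `B` that, when its ring is declared a dummy,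
restarts with rate `L` (`lintegral_exp_uniformization`). A dummy keeps the numbers of queries and
reports, and the age has reached the value it would have had anyway; since the policy is consulted
just before a transition, the original process restarted at a dummy epoch continues unchanged
(`Model.flux_drift`). Hence an original step is a uniformized step, followed by an original step if
a dummy occurred (`Model.lintegral_originalStep_eq`).

For whole sequences, products of weights of finitely many records are tested. Backward values `G` of
such a product are computed with the original kernel; the weights of the genuine records so far,
times `G` at the current record, have constant expectation along the uniformized chain
(`lintegral_genuineProd`). Almost surely there are infinitely many genuine transitions, so the limit
identifies the law of the thinned sequence (`map_removeDummies_recordLaw`).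

Finally, on almost every uniformized path, deletion changes neither the state at any time nor the
assignments nor the cost (`stateAt_removeDummies`, `tsum_removeDummies`); this uses that the epochs
are unbounded. As the original law is the image of the uniformized one under deletion, the joint
laws agree, and the claims on costs and optimal policies follow. -/

/-! ### One step of a chain as an explicit integral -/

lemma lintegral_stepKernel {r : ℕ × ℕ → ℝ} (hr : ∀ q, 0 < r q)
    (P : ℕ × ℕ × Action → PMF Transition) (p : Policy) (z : Record) {f : Record → ℝ≥0∞}
    (hf : Measurable f) :
    ∫⁻ y, f y ∂stepKernel r P p z =
      ∫⁻ v in Set.Ioi (0 : ℝ), ENNReal.ofReal (r (z.2.2.1, z.2.2.2.1) *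
        Real.exp (-(r (z.2.2.1, z.2.2.2.1) * v))) *
        ∑ a, P (z.2.2.1, z.2.2.2.1, p.act (drift z.2.2 v.toNNReal)) a *
          f (z.1 + v.toNNReal, a, Transition.apply a (drift z.2.2 v.toNNReal)) := by
  have := isMarkovKernel_holdingKernel hr
  have hstep : Measurable fun y : Record × (ℝ≥0 × Transition) =>
      f (y.1.1 + y.2.1, y.2.2, Transition.apply y.2.2 (drift y.1.2.2 y.2.1)) :=
    hf.comp measurable_stepMap
  have hsum : Measurable fun s : ℝ≥0 => ∑ a, P (z.2.2.1, z.2.2.2.1, p.act (drift z.2.2 s)) a *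
      f (z.1 + s, a, Transition.apply a (drift z.2.2 s)) := by
    refine Finset.measurable_sum _ fun a _ => ?_
    have h1 : Measurable fun s : ℝ≥0 => p.act (drift z.2.2 s) :=
      p.measurable_act.comp (measurable_drift.comp measurable_prodMk_left)
    refine ((measurable_of_countable fun d => P (z.2.2.1, z.2.2.2.1, d) a).comp h1).mul ?_
    exact hstep.comp (by fun_prop : Measurable fun s : ℝ≥0 => ((z, s, a) : Record × ℝ≥0 × Transition))
  have hleft : Measurable fun y : ℝ≥0 × Transition =>
      f (z.1 + y.1, y.2, Transition.apply y.2 (drift z.2.2 y.1)) :=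
    hstep.comp measurable_prodMk_left
  rw [stepKernel, Kernel.lintegral_map _ measurable_stepMap _ hf,
    Kernel.lintegral_id_prod hstep, Kernel.lintegral_comap, Kernel.lintegral_compProd _ _ _ hleft]
  have hsumR : Measurable fun v : ℝ => ∑ a, P (z.2.2.1, z.2.2.2.1,
      p.act (drift z.2.2 v.toNNReal)) a *
        f (z.1 + v.toNNReal, a, Transition.apply a (drift z.2.2 v.toNNReal)) :=
    hsum.comp measurable_real_toNNReal
  have hpdf : Measurable (gammaPDF 1 (r (z.2.2.1, z.2.2.2.1))) :=
    (measurable_gammaPDFReal 1 _).ennreal_ofReal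
  have hinner : ∀ s : ℝ≥0, ∫⁻ a, f (z.1 + s, a, Transition.apply a (drift z.2.2 s))
      ∂transitionKernel P p (z.2.2, s) =
      ∑ a, P (z.2.2.1, z.2.2.2.1, p.act (drift z.2.2 s)) a *
          f (z.1 + s, a, Transition.apply a (drift z.2.2 s)) := by
    intro s
    rw [lintegral_fintype]
    refine Finset.sum_congr rfl fun a _ => ?_
    rw [mul_comm, transitionKernel, Kernel.comap_apply]
    congr 1
    exact PMF.toMeasure_apply_singleton _ _ (MeasurableSet.singleton a)
  rw [lintegral_congr hinner, holdingKernel, Kernel.lintegral_comap]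
  change ∫⁻ s, _ ∂((expMeasure _).map Real.toNNReal) = _
  rw [lintegral_map hsum measurable_real_toNNReal, expMeasure, gammaMeasure,
    lintegral_withDensity_eq_lintegral_mul _ hpdf hsumR]
  -- The exponential density vanishes on the negative half-line, and the point `0` is null.
  rw [← lintegral_add_compl _ measurableSet_Ici (A := Set.Ici (0:ℝ)), Set.compl_Ici,
    setLIntegral_congr_fun (g := fun _ => 0) measurableSet_Iio, lintegral_zero, add_zero,
    setLIntegral_congr Ioi_ae_eq_Ici.symm]
  · refine setLIntegral_congr_fun measurableSet_Ioi fun v hv => ?_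
    simp only [Pi.mul_apply]
    congr 1
    exact exponentialPDF_of_nonneg (le_of_lt hv)
  · intro v hv
    simp only [Pi.mul_apply]
    rw [gammaPDF_of_neg hv, zero_mul]

/-! ### One original step versus one uniformized step -/

/-- The memorylessness computation behind uniformization. -/
lemma lintegral_exp_uniformization {L B : ℝ} (hLB : L ≤ B) {g : ℝ → ℝ≥0∞} (hg : Measurable g) :
    ∫⁻ v in Set.Ioi (0 : ℝ), ENNReal.ofReal (Real.exp (-(L * v))) * g v =
      ∫⁻ v in Set.Ioi (0 : ℝ), ENNReal.ofReal (Real.exp (-(B * v))) *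
        (g v + ENNReal.ofReal (B - L) *
          ∫⁻ u in Set.Ioi (0 : ℝ), ENNReal.ofReal (Real.exp (-(L * u))) * g (v + u)) := by
  -- The probability that a dummy clock of rate `B - L` rings before `y`.
  have hprim : ∀ y : ℝ, 0 < y → ∫⁻ v in Set.Ioo (0 : ℝ) y,
      ENNReal.ofReal ((B - L) * Real.exp (-((B - L) * v))) =
      ENNReal.ofReal (1 - Real.exp (-((B - L) * y))) := by
    intro y hy
    have hcont : Continuous fun v => (B - L) * Real.exp (-((B - L) * v)) := by fun_prop
    rw [setLIntegral_congr Ioo_ae_eq_Ioc, ← ofReal_integral_eq_lintegral_ofReal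
      (hcont.integrableOn_Ioc) (Filter.Eventually.of_forall fun v =>
        mul_nonneg (sub_nonneg.2 hLB) (Real.exp_pos _).le),
      ← intervalIntegral.integral_of_le hy.le,
      intervalIntegral.integral_eq_sub_of_hasDerivAt
        (fun x _ => hasDerivAt_neg_exp_mul_exp) (hcont.intervalIntegrable _ _)]
    simp
    ring_nf
  -- The weight at `y` is split according to whether the dummy clock has rung before `y`.
  have hmul : ∀ y : ℝ, 0 < y → ENNReal.ofReal (Real.exp (-(L * y))) =
      ENNReal.ofReal (Real.exp (-(B * y))) + ENNReal.ofReal (Real.exp (-(L * y))) *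
      ENNReal.ofReal (1 - Real.exp (-((B - L) * y))) := by
    intro y hy
    have h1 : 0 ≤ 1 - Real.exp (-((B - L) * y)) := by
      rw [sub_nonneg, Real.exp_le_one_iff]
      have := mul_nonneg (sub_nonneg.2 hLB) hy.le
      linarith
    rw [← ENNReal.ofReal_mul (Real.exp_pos _).le, ← ENNReal.ofReal_add (Real.exp_pos _).le
      (mul_nonneg (Real.exp_pos _).le h1), mul_sub, ← Real.exp_add]
    congr 1
    ring_nf
  have hshift : ∀ v : ℝ, ∫⁻ u in Set.Ioi (0 : ℝ), ENNReal.ofReal (Real.exp (-(L * u))) * g (v + u)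
      = ∫⁻ y in Set.Ioi v, ENNReal.ofReal (Real.exp (-(L * (y - v)))) * g y := by
    intro v
    rw [← lintegral_indicator measurableSet_Ioi, ← lintegral_indicator measurableSet_Ioi,
      ← lintegral_add_left_eq_self ((Set.Ioi v).indicator _) v]
    refine lintegral_congr fun u => ?_
    by_cases hu : 0 < u <;> simp [hu]
  -- Substitute `y = v + u` and apply Tonelli: since `exp (-B v) * exp (-L (y - v)) = exp (-L y) *
  -- exp (-(B - L) v)`, the integral over the dummy epoch `v < y` is `hprim`.
  have hdouble : ∫⁻ v in Set.Ioi (0 : ℝ), ENNReal.ofReal (Real.exp (-(B * v))) *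
        (ENNReal.ofReal (B - L) *
          ∫⁻ u in Set.Ioi (0 : ℝ), ENNReal.ofReal (Real.exp (-(L * u))) * g (v + u)) =
      ∫⁻ y in Set.Ioi (0 : ℝ), ENNReal.ofReal (Real.exp (-(L * y))) *
      ENNReal.ofReal (1 - Real.exp (-((B - L) * y))) * g y := by
    let k : ℝ → ℝ → ℝ≥0∞ := fun v y => (Set.Ioi v).indicator
      (fun y => ENNReal.ofReal ((B - L) * Real.exp (-((B - L) * v))) *
        (ENNReal.ofReal (Real.exp (-(L * y))) * g y)) y
    have hk : Measurable (Function.uncurry k) := by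
      have : Function.uncurry k = {z : ℝ × ℝ | z.1 < z.2}.indicator (fun z =>
        ENNReal.ofReal ((B - L) * Real.exp (-((B - L) * z.1))) *
        (ENNReal.ofReal (Real.exp (-(L * z.2))) * g z.2)) := rfl
      rw [this]
      refine Measurable.indicator (by fun_prop) (measurableSet_lt measurable_fst measurable_snd)
    have h1 : ∀ v : ℝ, ENNReal.ofReal (Real.exp (-(B * v))) * (ENNReal.ofReal (B - L) *
          ∫⁻ u in Set.Ioi (0 : ℝ), ENNReal.ofReal (Real.exp (-(L * u))) * g (v + u)) =
          ∫⁻ y, k v y := by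
      intro v
      rw [hshift, lintegral_indicator measurableSet_Ioi, ← mul_assoc,
        ← ENNReal.ofReal_mul (Real.exp_pos _).le, ← lintegral_const_mul _ (by fun_prop)]
      refine lintegral_congr fun y => ?_
      rw [← mul_assoc, ← mul_assoc, ← ENNReal.ofReal_mul (mul_nonneg (Real.exp_pos _).le
        (sub_nonneg.2 hLB)), ← ENNReal.ofReal_mul (mul_nonneg (sub_nonneg.2 hLB)
          (Real.exp_pos _).le), mul_comm (Real.exp _) (B - L), mul_assoc, mul_assoc,
          ← Real.exp_add, ← Real.exp_add]
      ring_nf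
    rw [lintegral_congr h1, lintegral_lintegral_swap hk.aemeasurable,
      ← lintegral_indicator measurableSet_Ioi]
    refine lintegral_congr fun y => ?_
    by_cases hy : 0 < y
    · rw [Set.indicator_of_mem (Set.mem_Ioi.2 hy), ← hprim y hy]
      have h2 : ∀ v, k v y = (Set.Iio y).indicator (fun v =>
          ENNReal.ofReal ((B - L) * Real.exp (-((B - L) * v)))) v *
          (ENNReal.ofReal (Real.exp (-(L * y))) * g y) := by
        intro v
        by_cases hv : v < y <;> simp [k, hv]
      rw [lintegral_congr h2, lintegral_mul_const _ (Measurable.indicator (by fun_prop)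
        measurableSet_Iio), setLIntegral_indicator measurableSet_Iio,
        Set.inter_comm, Set.Ioi_inter_Iio]
      ring
    · rw [Set.indicator_of_notMem (by simpa using hy),
        setLIntegral_congr_fun (g := fun _ => 0) measurableSet_Ioi, lintegral_zero]
      intro v hv
      have : ¬ v < y := fun h => hy (lt_trans hv h)
      simp [k, this]
  have hmeas : Measurable fun v : ℝ => ENNReal.ofReal (Real.exp (-(B * v))) * g v := by fun_prop
  simp only [mul_add]
  rw [lintegral_add_left hmeas, hdouble, ← lintegral_add_left hmeas]
  refine setLIntegral_congr_fun measurableSet_Ioi fun y hy => ?_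
  simpa only [add_mul] using congrArg (· * g y) (hmul y hy)

/-- The transition kernel of the original process. -/
noncomputable abbrev Model.originalStep (M : Model) (p : Policy) : Kernel Record Record :=
  stepKernel (fun q => M.totalRate q.1 q.2) M.jumpPMF p

/-- The transition kernel of the uniformized process. -/
noncomputable abbrev Model.uniformizedStep (M : Model) (B : ℝ) (hB : M.lam1 + M.lam2 + M.mu ≤ B)
    (p : Policy) : Kernel Record Record :=
  stepKernel (fun _ => B) (M.unifPMF B hB) p

/-- The sum over the transitions, weighted with their rates, of the values of `f` at the records
that they create, when they take place `v` time units after the record `z`. -/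
noncomputable def Model.flux (M : Model) (p : Policy) (z : Record) (f : Record → ℝ≥0∞)
    (v : ℝ) : ℝ≥0∞ :=
  ∑ a, ENNReal.ofReal (M.rate z.2.2.1 z.2.2.2.1 (p.act (drift z.2.2 v.toNNReal)) a) *
    f (z.1 + v.toNNReal, a, Transition.apply a (drift z.2.2 v.toNNReal))

lemma Model.measurable_flux (M : Model) (p : Policy) (z : Record) {f : Record → ℝ≥0∞}
    (hf : Measurable f) : Measurable (M.flux p z f) := by
  refine Finset.measurable_sum _ fun a _ => ?_
  have hd : Measurable fun v : ℝ => drift z.2.2 v.toNNReal :=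
    (measurable_drift.comp measurable_prodMk_left).comp measurable_real_toNNReal
  refine ((measurable_of_countable fun d =>
    ENNReal.ofReal (M.rate z.2.2.1 z.2.2.2.1 d a)).comp (p.measurable_act.comp hd)).mul ?_
  have ha : Measurable fun v : ℝ => Transition.apply a (drift z.2.2 v.toNNReal) :=
    (Transition.measurable_apply.comp measurable_prodMk_left).comp hd
  exact hf.comp (by fun_prop)

/-- The dummy transition has rate `0`, so the flux never sees the values of `f` at dummy records. -/
lemma Model.flux_congr (M : Model) (p : Policy) (z : Record) {f g : Record → ℝ≥0∞} {v : ℝ}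
    (h : ∀ y : Record, y.2.1 ≠ .dummy → f y = g y) : M.flux p z f v = M.flux p z g v := by
  refine Finset.sum_congr rfl fun a _ => ?_
  by_cases ha : a = .dummy
  · simp [ha, Model.rate]
  · rw [h _ ha]

/-- Drifts compose additively and keep the numbers of jobs, so both the rates and the prescribed
action depend only on the total elapsed time. This makes a dummy epoch invisible to the original
dynamics. -/
lemma Model.flux_drift (M : Model) (p : Policy) (z : Record) (f : Record → ℝ≥0∞) {v u : ℝ}
    (hv : 0 ≤ v) (hu : 0 ≤ u) :
    M.flux p (z.1 + v.toNNReal, .dummy, drift z.2.2 v.toNNReal) f u = M.flux p z f (v + u) := by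
  have hd : drift (drift z.2.2 v.toNNReal) u.toNNReal = drift z.2.2 (v + u).toNNReal := by
    simp [drift, Real.toNNReal_add hv hu, add_assoc]
  simp only [Model.flux, hd]
  simp [drift, Real.toNNReal_add hv hu, add_assoc]

lemma Model.lintegral_originalStep (M : Model) (p : Policy) (z : Record) {f : Record → ℝ≥0∞}
    (hf : Measurable f) :
    ∫⁻ y, f y ∂M.originalStep p z = ∫⁻ v in Set.Ioi (0 : ℝ),
      ENNReal.ofReal (Real.exp (-(M.totalRate z.2.2.1 z.2.2.2.1 * v))) * M.flux p z f v := by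
  rw [lintegral_stepKernel (fun q => M.totalRate_pos q.1 q.2) _ _ _ hf]
  refine lintegral_congr fun v => ?_
  have hL := M.totalRate_pos z.2.2.1 z.2.2.2.1
  rw [Model.flux, Finset.mul_sum, Finset.mul_sum]
  refine Finset.sum_congr rfl fun a _ => ?_
  simp only [Model.jumpPMF, PMF.ofFintype_apply]
  rw [← mul_assoc, ← mul_assoc, ← ENNReal.ofReal_mul (mul_nonneg hL.le (Real.exp_pos _).le),
    ← ENNReal.ofReal_mul (Real.exp_pos _).le]
  congr 2
  field_simp

lemma Model.lintegral_uniformizedStep (M : Model) {B : ℝ} (hB : M.lam1 + M.lam2 + M.mu ≤ B)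
    (p : Policy) (z : Record) {f : Record → ℝ≥0∞} (hf : Measurable f) :
    ∫⁻ y, f y ∂M.uniformizedStep B hB p z = ∫⁻ v in Set.Ioi (0 : ℝ),
      ENNReal.ofReal (Real.exp (-(B * v))) * (M.flux p z f v +
        ENNReal.ofReal (B - M.totalRate z.2.2.1 z.2.2.2.1) *
          f (z.1 + v.toNNReal, .dummy, drift z.2.2 v.toNNReal)) := by
  rw [lintegral_stepKernel (fun _ => M.B_pos hB) _ _ _ hf]
  refine lintegral_congr fun v => ?_
  have hB0 := M.B_pos hB
  have hsum : ∀ F : Transition → ℝ≥0∞, ∑ a, F a = ∑ a ∈ Finset.univ.erase .dummy, F a + F .dummy :=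
    fun F => (Finset.sum_erase_add _ _ (Finset.mem_univ _)).symm
  rw [Model.flux, hsum, hsum (fun a => ENNReal.ofReal (M.rate _ _ _ a) * _), Model.rate,
    ENNReal.ofReal_zero, zero_mul, add_zero, mul_add, mul_add, Finset.mul_sum, Finset.mul_sum]
  simp only [Model.unifPMF, PMF.ofFintype_apply]
  congr 1
  · refine Finset.sum_congr rfl fun a ha => ?_
    have ha : a ≠ .dummy := Finset.ne_of_mem_erase ha
    rw [← mul_assoc, ← mul_assoc, ← ENNReal.ofReal_mul (mul_nonneg hB0.le (Real.exp_pos _).le),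
      ← ENNReal.ofReal_mul (Real.exp_pos _).le]
    congr 2
    cases a <;> simp only [Model.unifProb] <;> first | exact absurd rfl ha | field_simp
  · rw [← mul_assoc, ← mul_assoc, ← ENNReal.ofReal_mul (mul_nonneg hB0.le (Real.exp_pos _).le),
      ← ENNReal.ofReal_mul (Real.exp_pos _).le]
    congr 2
    simp only [Model.unifProb]
    field_simp

/-- The first genuine transition of the uniformized process has the law of the next transition
of the original process. -/
lemma Model.lintegral_originalStep_eq (M : Model) {B : ℝ} (hB : M.lam1 + M.lam2 + M.mu ≤ B)
    (p : Policy) (z : Record) {f : Record → ℝ≥0∞} (hf : Measurable f) :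
    ∫⁻ y, f y ∂M.originalStep p z = ∫⁻ y, (if y.2.1 = .dummy then ∫⁻ y', f y' ∂M.originalStep p y
      else f y) ∂M.uniformizedStep B hB p z := by
  have hg : Measurable fun y : Record => if y.2.1 = .dummy then ∫⁻ y', f y' ∂M.originalStep p y
      else f y :=
    Measurable.ite (measurable_snd.fst (MeasurableSet.singleton Transition.dummy))
      hf.lintegral_kernel hf
  rw [M.lintegral_uniformizedStep hB p z hg, M.lintegral_originalStep p z hf,
    lintegral_exp_uniformization ((M.totalRate_le _ _).trans hB) (M.measurable_flux p z hf)]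
  refine setLIntegral_congr_fun measurableSet_Ioi fun v hv => ?_
  simp only
  congr 2
  · exact M.flux_congr p z fun y hy => by simp [hy]
  -- The original process restarted after the dummy has the same total rate, as the drift keeps `i`
  -- and `j`; this is what the final `rfl` checks.
  · rw [if_pos trivial, M.lintegral_originalStep p _ hf]
    congr 1
    refine setLIntegral_congr_fun measurableSet_Ioi fun u hu => ?_
    rw [M.flux_drift p z f (le_of_lt hv) (le_of_lt hu)]
    rfl

lemma lintegral_exp_neg_mul_Ioi {b : ℝ} (hb : 0 < b) :
    ∫⁻ v in Set.Ioi (0 : ℝ), ENNReal.ofReal (Real.exp (-(b * v))) = ENNReal.ofReal (1 / b) := by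
  have hb' : -b < 0 := by linarith
  simp only [← neg_mul]
  rw [← ofReal_integral_eq_lintegral_ofReal (integrableOn_exp_mul_Ioi hb' 0)
    (Filter.Eventually.of_forall fun v => (Real.exp_pos _).le), integral_exp_mul_Ioi hb' 0]
  simp

/-! ### One-step bounds and the deterministic structure of a step -/

/-- Dummy transitions have a probability bounded away from `1`. -/
lemma Model.exists_lintegral_dummy_le (M : Model) {B : ℝ} (hB : M.lam1 + M.lam2 + M.mu ≤ B)
    (p : Policy) : ∃ q : ℝ≥0∞, q < 1 ∧ ∀ z, ∫⁻ y, (if y.2.1 = Transition.dummy then 1 else 0)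
      ∂M.uniformizedStep B hB p z ≤ q := by
  have hB0 := M.B_pos hB
  have h1 := M.lam1_pos
  have h2 := M.lam2_pos
  have h3 := M.mu_pos
  -- Arrivals are possible in every state, so the total rate is at least `lam1 + lam2`, even in an
  -- empty system.
  refine ⟨ENNReal.ofReal ((B - (M.lam1 + M.lam2)) * (1 / B)), ?_, fun z => ?_⟩
  · rw [ENNReal.ofReal_lt_one, mul_one_div, div_lt_one hB0]
    linarith
  have hf : Measurable fun y : Record => if y.2.1 = Transition.dummy then (1 : ℝ≥0∞) else 0 :=
    Measurable.ite (measurable_snd.fst (MeasurableSet.singleton Transition.dummy))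
      measurable_const measurable_const
  have hflux : ∀ v, M.flux p z
      (fun y : Record => if y.2.1 = Transition.dummy then (1 : ℝ≥0∞) else 0) v = 0 := by
    intro v
    rw [M.flux_congr p z (g := fun _ => 0) fun y hy => by simp [hy]]
    simp [Model.flux]
  rw [M.lintegral_uniformizedStep hB p z hf]
  simp only [hflux, if_true, mul_one, zero_add]
  rw [lintegral_mul_const _ (by fun_prop), lintegral_exp_neg_mul_Ioi hB0,
    ← ENNReal.ofReal_mul (by positivity), mul_comm]
  have : M.lam1 + M.lam2 ≤ M.totalRate z.2.2.1 z.2.2.2.1 := by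
    unfold Model.totalRate
    split_ifs <;> linarith
  gcongr

lemma sum_pmf_eq_one (P : PMF Transition) : ∑ a, P a = 1 := by
  rw [← tsum_fintype (L := .unconditional _), P.tsum_coe]

/-- The expected discount factor over one step of the uniformized process. -/
lemma Model.lintegral_exp_uniformizedStep (M : Model) {B : ℝ} (hB : M.lam1 + M.lam2 + M.mu ≤ B)
    (p : Policy) (z : Record) :
    ∫⁻ y, ENNReal.ofReal (Real.exp (z.1 - y.1)) ∂M.uniformizedStep B hB p z =
      ENNReal.ofReal (B / (B + 1)) := by
  have hB0 := M.B_pos hB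
  rw [lintegral_stepKernel (fun _ => hB0) _ _ _ (by fun_prop)]
  simp only [← Finset.sum_mul, sum_pmf_eq_one, one_mul]
  -- The density `B * exp (-B v)` times the discount `exp (-v)`: the Laplace transform of the
  -- exponential law at `1`.
  rw [setLIntegral_congr_fun (g := fun v => ENNReal.ofReal B *
    ENNReal.ofReal (Real.exp (-((B + 1) * v)))) measurableSet_Ioi,
    lintegral_const_mul _ (by fun_prop), lintegral_exp_neg_mul_Ioi (by linarith),
    ← ENNReal.ofReal_mul hB0.le, mul_one_div]
  intro v hv
  have hv : 0 ≤ v := le_of_lt hv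
  simp only
  rw [← ENNReal.ofReal_mul (mul_nonneg hB0.le (Real.exp_pos _).le),
    ← ENNReal.ofReal_mul hB0.le, mul_assoc, ← Real.exp_add, NNReal.coe_add, Real.coe_toNNReal v hv]
  ring_nf

/-- The deterministic relation between the records of two consecutive transitions: time does not
run backwards, and a dummy transition only lets the state drift. -/
def IsStep (z y : Record) : Prop :=
  z.1 ≤ y.1 ∧ (y.2.1 = Transition.dummy → y.2.2 = drift z.2.2 (y.1 - z.1))

lemma measurableSet_isStep : MeasurableSet {z : Record × Record | IsStep z.1 z.2} := by
  have h1 : MeasurableSet {z : Record × Record | z.1.1 ≤ z.2.1} :=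
    measurableSet_le (by fun_prop) (by fun_prop)
  have h2 : MeasurableSet {z : Record × Record | z.2.2.1 = Transition.dummy} :=
    measurableSet_eq_fun (by fun_prop) (by fun_prop)
  have h3 : MeasurableSet {z : Record × Record | z.2.2.2 = drift z.1.2.2 (z.2.1 - z.1.1)} :=
    measurableSet_eq_fun (by fun_prop) (measurable_drift.comp
      (by fun_prop : Measurable fun z : Record × Record => (z.1.2.2, z.2.1 - z.1.1)))
  convert h1.inter (h2.compl.union h3) using 1
  ext z
  simp [IsStep, imp_iff_not_or]

open Classical in
lemma lintegral_not_isStep {r : ℕ × ℕ → ℝ} (hr : ∀ q, 0 < r q)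
    (P : ℕ × ℕ × Action → PMF Transition) (p : Policy) (z : Record) :
    ∫⁻ y, (if IsStep z y then 0 else 1) ∂stepKernel r P p z = 0 := by
  have hm : Measurable fun y => if IsStep z y then (0 : ℝ≥0∞) else 1 :=
    Measurable.ite (measurableSet_isStep.preimage measurable_prodMk_left) measurable_const
      measurable_const
  rw [lintegral_stepKernel hr _ _ _ hm]
  have : ∀ (s : ℝ≥0) a, IsStep z (z.1 + s, a, Transition.apply a (drift z.2.2 s)) := by
    intro s a
    refine ⟨le_self_add, fun ha => ?_⟩
    simp only at ha
    simp [ha, Transition.apply, drift]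
  simp [this]

instance isProbabilityMeasure_recordLaw (K : Kernel Record Record) (hK : IsMarkovKernel K)
    (x : State) : IsProbabilityMeasure (recordLaw K hK x) := by
  unfold recordLaw
  infer_instance

/-! ### The law of the sequence of records -/

/-- The Markov property. -/
lemma lintegral_recordLaw (K : Kernel Record Record) (hK : IsMarkovKernel K) (x : State) (m : ℕ)
    {F : (ℕ → Record) → Record → ℝ≥0∞} (hF : Measurable (Function.uncurry F))
    (hdep : ∀ w r, F (fun k => w (min k m)) r = F w r) :
    ∫⁻ w, F w (w (m + 1)) ∂recordLaw K hK x = ∫⁻ w, ∫⁻ r, F w r ∂K (w m) ∂recordLaw K hK x := by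
  let κ : (n : ℕ) → Kernel ((i : Finset.Iic n) → Record) Record := fun n =>
    K.comap (fun h : (i : Finset.Iic n) → Record => h ⟨n, by simp⟩) (measurable_pi_apply _)
  -- A finite history is extended to a sequence by freezing its last record; by `hdep` the
  -- functional `F` does not notice.
  let ext : ((i : Finset.Iic m) → Record) → ℕ → Record := fun h k => h ⟨min k m, by simp⟩
  have hext : Measurable ext := by fun_prop
  have hF' : Measurable fun z : ((i : Finset.Iic m) → Record) × Record => F (ext z.1) z.2 :=
    hF.comp (by fun_prop : Measurable fun z : ((i : Finset.Iic m) → Record) × Record =>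
      (ext z.1, z.2))
  have key := Kernel.map_frestrictLe_trajMeasure_compProd_eq_map_trajMeasure
    (X := fun _ => Record) (κ := κ) (μ₀ := Measure.dirac ((0, Transition.dummy, x) : Record))
    (a := m)
  have := congrArg (fun μ => ∫⁻ z, F (ext z.1) z.2 ∂μ) key
  rw [Measure.lintegral_compProd hF', lintegral_map hF' (by fun_prop), lintegral_map
    hF'.lintegral_kernel_prod_right' (by fun_prop)] at this
  have hr : ∀ w r, F (ext (Preorder.frestrictLe m w)) r = F w r := fun w r => hdep w r
  simp only [hr] at this
  exact this.symm

lemma ae_recordLaw_zero (K : Kernel Record Record) (hK : IsMarkovKernel K) (x : State) :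
    ∀ᵐ w ∂recordLaw K hK x, w 0 = (0, Transition.dummy, x) := by
  have hmap : (recordLaw K hK x).map (Preorder.frestrictLe 0) =
      (Measure.dirac ((0, Transition.dummy, x) : Record)).map
        (MeasurableEquiv.piUnique (fun _ : Finset.Iic 0 => Record)).symm := by
    rw [recordLaw, Kernel.trajMeasure, Measure.map_comp _ _ (by fun_prop),
      Kernel.traj_map_frestrictLe, Kernel.partialTraj_self]
    exact Measure.id_comp
  have hmap := hmap.trans (Measure.map_dirac' (MeasurableEquiv.measurable _) _)
  have hae : ∀ᵐ h ∂(recordLaw K hK x).map (Preorder.frestrictLe 0),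
      h ⟨0, by simp⟩ = ((0, Transition.dummy, x) : Record) := by
    rw [hmap, ae_dirac_iff (measurableSet_eq_fun (by fun_prop) measurable_const)]
    rfl
  exact ae_of_ae_map (by fun_prop) hae

/-! ### Deleting the dummy transitions from a path -/

/-- The indices of the initial record and of the genuine transitions. -/
def IsGenuine (w : ℕ → Record) (k : ℕ) : Prop := k = 0 ∨ (w k).2.1 ≠ Transition.dummy

instance (w : ℕ → Record) : DecidablePred (IsGenuine w) := fun _ =>
  inferInstanceAs (Decidable (_ ∨ _))

/-- The sequence of records without the dummy transitions. -/
noncomputable def removeDummies (w : ℕ → Record) (n : ℕ) : Record := w (Nat.nth (IsGenuine w) n)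

/-- The number of genuine transitions among the first `k` transitions. -/
def genuineCount (w : ℕ → Record) : ℕ → ℕ
  | 0 => 0
  | k + 1 => if (w (k + 1)).2.1 = Transition.dummy then genuineCount w k else genuineCount w k + 1

/-- The extra `1` is the initial record, which `IsGenuine` includes and `genuineCount` does not. -/
lemma count_isGenuine (w : ℕ → Record) (k : ℕ) :
    Nat.count (IsGenuine w) (k + 1) = genuineCount w k + 1 := by
  induction k with
  | zero => simp [Nat.count_succ, IsGenuine, genuineCount]
  | succ k ih =>
    rw [Nat.count_succ, ih, genuineCount]
    by_cases h : (w (k + 1)).2.1 = Transition.dummy <;> simp [IsGenuine, h]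

lemma genuineCount_mono (w : ℕ → Record) : Monotone (genuineCount w) := by
  refine monotone_nat_of_le_succ fun k => ?_
  rw [genuineCount]
  split_ifs <;> omega

lemma removeDummies_zero (w : ℕ → Record) : removeDummies w 0 = w 0 := by
  have h : IsGenuine w 0 := Or.inl rfl
  rw [removeDummies, Nat.nth_zero_of_zero h]

lemma removeDummies_genuineCount (w : ℕ → Record) {k : ℕ} (hk : IsGenuine w k) :
    removeDummies w (genuineCount w k) = w k := by
  have h : Nat.count (IsGenuine w) k = genuineCount w k := by
    have := count_isGenuine w k
    rw [Nat.count_succ, if_pos hk] at this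
    omega
  rw [removeDummies, ← h, Nat.nth_count hk]

/-- Expresses the event through finitely many records, as needed for measurability. Only positive
values of `Nat.nth` are considered, because `0` is also its default when there are too few genuine
indices. -/
lemma nth_isGenuine_eq_succ_iff {w : ℕ → Record} {n m : ℕ} :
    Nat.nth (IsGenuine w) n = m + 1 ↔ IsGenuine w (m + 1) ∧ genuineCount w (m + 1) = n := by
  have hc := count_isGenuine w (m + 1)
  constructor
  · intro h
    have hn : ∀ hf : Set.Finite {k | IsGenuine w k}, n < hf.toFinset.card := by
      intro hf
      by_contra hlt
      exact absurd ((Nat.nth_of_card_le hf (not_lt.1 hlt)).symm.trans h) (by simp)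
    have hmem := Nat.nth_mem n hn
    have hcount := Nat.count_nth hn
    rw [h] at hmem hcount
    rw [Nat.count_succ, if_pos hmem, hcount] at hc
    exact ⟨hmem, by omega⟩
  · rintro ⟨h1, h2⟩
    rw [Nat.count_succ, if_pos h1] at hc
    have : n = Nat.count (IsGenuine w) (m + 1) := by omega
    rw [this, Nat.nth_count h1]

lemma eventually_le_genuineCount {w : ℕ → Record} (hw : {k | IsGenuine w k}.Infinite) (n : ℕ) :
    ∀ᶠ k in Filter.atTop, n ≤ genuineCount w k := by
  refine Filter.eventually_atTop.2 ⟨Nat.nth (IsGenuine w) n, fun k hk => ?_⟩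
  refine le_trans ?_ (genuineCount_mono w hk)
  have := count_isGenuine w (Nat.nth (IsGenuine w) n)
  rw [Nat.count_nth_succ_of_infinite hw] at this
  omega

lemma measurableSet_isGenuine (k : ℕ) : MeasurableSet {w : ℕ → Record | IsGenuine w k} := by
  refine (MeasurableSet.const _).union (MeasurableSet.compl ?_)
  exact measurableSet_eq_fun (by fun_prop) measurable_const

lemma measurable_genuineCount (k : ℕ) : Measurable fun w => genuineCount w k := by
  induction k with
  | zero => exact measurable_const
  | succ k ih =>
    exact Measurable.ite (measurableSet_eq_fun (by fun_prop) measurable_const) ih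
      (ih.add_const 1)

lemma measurable_removeDummies : Measurable removeDummies := by
  refine measurable_pi_iff.2 fun n => ?_
  have hpos : ∀ m, MeasurableSet {w : ℕ → Record | Nat.nth (IsGenuine w) n = m + 1} := by
    intro m
    have : {w : ℕ → Record | Nat.nth (IsGenuine w) n = m + 1} =
        {w | IsGenuine w (m + 1)} ∩ {w | genuineCount w (m + 1) = n} :=
      Set.ext fun w => nth_isGenuine_eq_succ_iff
    rw [this]
    exact (measurableSet_isGenuine _).inter
      (measurableSet_eq_fun (measurable_genuineCount _) measurable_const)
  have hidx : Measurable fun w : ℕ → Record => Nat.nth (IsGenuine w) n := by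
    refine measurable_to_countable' fun m => ?_
    cases m with
    | succ m => exact hpos m
    -- The value `0`, default or not, is what remains when all positive values are excluded.
    | zero =>
      have : (fun w : ℕ → Record => Nat.nth (IsGenuine w) n) ⁻¹' {0} =
          (⋃ m, {w : ℕ → Record | Nat.nth (IsGenuine w) n = m + 1})ᶜ := by
        ext w
        simp only [Set.mem_preimage, Set.mem_singleton_iff, Set.mem_compl_iff, Set.mem_iUnion,
          Set.mem_ofPred_eq, not_exists]
        refine ⟨fun h m => by omega, fun h => ?_⟩
        by_contra h0
        exact h (Nat.nth (IsGenuine w) n - 1) (by omega)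
      rw [this]
      exact (MeasurableSet.iUnion hpos).compl
  have heval : Measurable fun z : ℕ × (ℕ → Record) => z.2 z.1 :=
    measurable_from_prod_countable_right fun k => measurable_pi_apply k
  exact heval.comp (hidx.prodMk measurable_id)

/-! ### The law of the thinned chain -/

/-- The product of the weights `φ` of the genuine records among the first `k` transitions. -/
noncomputable def genuineProd (φ : ℕ → Record → ℝ≥0∞) (w : ℕ → Record) : ℕ → ℝ≥0∞
  | 0 => φ 0 (w 0)
  | k + 1 => if (w (k + 1)).2.1 = Transition.dummy then genuineProd φ w k
      else genuineProd φ w k * φ (genuineCount w k + 1) (w (k + 1))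

/-- Links the recursive form, which suits the Markov property, to the thinned sequence. -/
lemma genuineProd_eq (φ : ℕ → Record → ℝ≥0∞) (w : ℕ → Record) (k : ℕ) :
    genuineProd φ w k = ∏ i ∈ Finset.range (genuineCount w k + 1), φ i (removeDummies w i) := by
  induction k with
  | zero => simp [genuineProd, genuineCount, removeDummies_zero]
  | succ k ih =>
    by_cases h : (w (k + 1)).2.1 = Transition.dummy
    · simp [genuineProd, genuineCount, h, ih]
    · have h1 : genuineCount w (k + 1) = genuineCount w k + 1 := by simp [genuineCount, h]
      have h2 := removeDummies_genuineCount w (k := k + 1) (Or.inr h)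
      rw [h1, Finset.prod_range_succ, ← ih, ← h1, h2, genuineProd, if_neg h, h1]

lemma measurable_uncurry_nat {φ : ℕ → Record → ℝ≥0∞} (hφ : ∀ i, Measurable (φ i)) :
    Measurable fun z : ℕ × Record => φ z.1 z.2 :=
  measurable_from_prod_countable_right hφ

lemma measurable_genuineProd {φ : ℕ → Record → ℝ≥0∞} (hφ : ∀ i, Measurable (φ i)) (k : ℕ) :
    Measurable fun w => genuineProd φ w k := by
  induction k with
  | zero => exact (hφ 0).comp (measurable_pi_apply 0)
  | succ k ih =>
    refine Measurable.ite (measurableSet_eq_fun (by fun_prop) measurable_const) ih (ih.mul ?_)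
    exact (measurable_uncurry_nat hφ).comp
      (((measurable_genuineCount k).add_const 1).prodMk (measurable_pi_apply _))

lemma genuineCount_congr {w w' : ℕ → Record} {m : ℕ} (h : ∀ k ≤ m, w k = w' k) :
    genuineCount w m = genuineCount w' m := by
  induction m with
  | zero => rfl
  | succ m ih => rw [genuineCount, genuineCount, ih fun k hk => h k (by omega), h _ le_rfl]

lemma genuineProd_congr (φ : ℕ → Record → ℝ≥0∞) {w w' : ℕ → Record} {m : ℕ}
    (h : ∀ k ≤ m, w k = w' k) : genuineProd φ w m = genuineProd φ w' m := by
  induction m with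
  | zero => rw [genuineProd, genuineProd, h _ le_rfl]
  | succ m ih =>
    have h' : ∀ k ≤ m, w k = w' k := fun k hk => h k (by omega)
    rw [genuineProd, genuineProd, ih h', h _ le_rfl, genuineCount_congr h']

/-- `G i` gives, by backward induction, the expected product of the weights of the records after
record `i`. -/
lemma exists_backward_values (K : Kernel Record Record) [IsMarkovKernel K]
    {φ : ℕ → Record → ℝ≥0∞} (hφ : ∀ i, Measurable (φ i)) (hle : ∀ i z, φ i z ≤ 1) {n : ℕ}
    (hone : ∀ i, n < i → ∀ z, φ i z = 1) :
    ∃ G : ℕ → Record → ℝ≥0∞, (∀ i, Measurable (G i)) ∧ (∀ i z, G i z ≤ 1) ∧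
      (∀ i, n ≤ i → ∀ z, G i z = 1) ∧
      ∀ i z, G i z = ∫⁻ y, φ (i + 1) y * G (i + 1) y ∂K z := by
  -- `V k i` looks `k` steps ahead from record `i`. Taking `k = n - i` with truncated subtraction
  -- gives `1` beyond `n`, consistent with the recursion because the later weights are `1` and `K`
  -- is Markov.
  let V : ℕ → ℕ → Record → ℝ≥0∞ := fun k => Nat.rec (fun _ _ => 1)
    (fun _ v i z => ∫⁻ y, φ (i + 1) y * v (i + 1) y ∂K z) k
  have hV : ∀ k i z, V (k + 1) i z = ∫⁻ y, φ (i + 1) y * V k (i + 1) y ∂K z :=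
    fun _ _ _ => rfl
  have hmeas : ∀ k i, Measurable (V k i) := by
    intro k
    induction k with
    | zero => exact fun i => measurable_const
    | succ k ih => exact fun i => ((hφ (i + 1)).mul (ih (i + 1))).lintegral_kernel
  have hbound : ∀ k i z, V k i z ≤ 1 := by
    intro k
    induction k with
    | zero => exact fun _ _ => le_rfl
    | succ k ih =>
      intro i z
      rw [hV]
      refine (lintegral_mono fun y => mul_le_one' (hle _ y) (ih _ y)).trans ?_
      simp
  refine ⟨fun i => V (n - i) i, fun i => hmeas _ i, fun i => hbound _ i, fun i hi z => ?_,
    fun i z => ?_⟩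
  · simp only [Nat.sub_eq_zero_of_le hi]
    rfl
  · by_cases hi : i < n
    · have : n - i = (n - (i + 1)) + 1 := by omega
      simp only
      rw [this, hV]
    · have h1 : n - i = 0 := by omega
      have h2 : n - (i + 1) = 0 := by omega
      simp only [h1, h2, hone (i + 1) (by omega)]
      change (1 : ℝ≥0∞) = ∫⁻ y, 1 * 1 ∂K z
      simp

lemma lintegral_recordLaw_zero (K : Kernel Record Record) (hK : IsMarkovKernel K) (x : State)
    (f : Record → ℝ≥0∞) :
    ∫⁻ w, f (w 0) ∂recordLaw K hK x = f (0, Transition.dummy, x) := by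
  rw [lintegral_congr_ae (g := fun _ => f (0, Transition.dummy, x))
    ((ae_recordLaw_zero K hK x).mono fun w hw => by simp [hw])]
  simp

/-- By `hrec`, the integrand is a martingale in `m`, so its expectation keeps its initial value. -/
lemma lintegral_prod_recordLaw (K : Kernel Record Record) (hK : IsMarkovKernel K) (x : State)
    {φ G : ℕ → Record → ℝ≥0∞} (hφ : ∀ i, Measurable (φ i)) (hG : ∀ i, Measurable (G i))
    (hrec : ∀ i z, G i z = ∫⁻ y, φ (i + 1) y * G (i + 1) y ∂K z) (m : ℕ) :
    ∫⁻ w, (∏ i ∈ Finset.range (m + 1), φ i (w i)) * G m (w m) ∂recordLaw K hK x =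
      φ 0 (0, Transition.dummy, x) * G 0 (0, Transition.dummy, x) := by
  induction m with
  | zero =>
    simp only [zero_add, Finset.prod_range_one]
    exact lintegral_recordLaw_zero K hK x fun z => φ 0 z * G 0 z
  | succ m ih =>
    have hF : Measurable (Function.uncurry fun (w : ℕ → Record) (r : Record) =>
        (∏ i ∈ Finset.range (m + 1), φ i (w i)) * (φ (m + 1) r * G (m + 1) r)) := by
      simp only [Function.uncurry_def]
      fun_prop
    have key := lintegral_recordLaw K hK x m hF (fun w r => by
      congr 1
      refine Finset.prod_congr rfl fun i hi => ?_
      simp only [min_eq_left (Finset.mem_range_succ_iff.1 hi)])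
    rw [← ih]
    simp only [Finset.prod_range_succ _ (m + 1), mul_assoc]
    rw [key]
    refine lintegral_congr fun w => ?_
    rw [lintegral_const_mul _ (by fun_prop), ← hrec]

/-- The same martingale survives along the chain with dummies: `hstep` says that averaging `G c`
after a dummy, and the next weight times `G (c + 1)` after a genuine transition, returns `G c`. -/
lemma lintegral_genuineProd (Ko Ku : Kernel Record Record) (hKu : IsMarkovKernel Ku)
    (hstep : ∀ (z : Record) (f : Record → ℝ≥0∞), Measurable f → ∫⁻ y, f y ∂Ko z =
      ∫⁻ y, (if y.2.1 = Transition.dummy then ∫⁻ y', f y' ∂Ko y else f y) ∂Ku z) (x : State)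
    {φ G : ℕ → Record → ℝ≥0∞} (hφ : ∀ i, Measurable (φ i)) (hG : ∀ i, Measurable (G i))
    (hrec : ∀ i z, G i z = ∫⁻ y, φ (i + 1) y * G (i + 1) y ∂Ko z) (m : ℕ) :
    ∫⁻ w, genuineProd φ w m * G (genuineCount w m) (w m) ∂recordLaw Ku hKu x =
      φ 0 (0, Transition.dummy, x) * G 0 (0, Transition.dummy, x) := by
  induction m with
  | zero => exact lintegral_recordLaw_zero Ku hKu x fun z => φ 0 z * G 0 z
  | succ m ih =>
    let g : ℕ → Record → ℝ≥0∞ := fun c r => if r.2.1 = Transition.dummy then G c r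
      else φ (c + 1) r * G (c + 1) r
    have hg : ∀ c, Measurable (g c) := fun c =>
      Measurable.ite (measurableSet_eq_fun (by fun_prop) measurable_const) (hG c)
        ((hφ _).mul (hG _))
    have hF : Measurable (Function.uncurry fun (w : ℕ → Record) (r : Record) =>
        genuineProd φ w m * g (genuineCount w m) r) :=
      ((measurable_genuineProd hφ m).comp measurable_fst).mul
        ((measurable_uncurry_nat hg).comp
          (((measurable_genuineCount m).comp measurable_fst).prodMk measurable_snd))
    have key := lintegral_recordLaw Ku hKu x m hF (fun w r => by
      have h : ∀ k ≤ m, w (min k m) = w k := fun k hk => by rw [min_eq_left hk]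
      rw [genuineProd_congr φ h, genuineCount_congr h])
    rw [← ih, lintegral_congr (g := fun w => genuineProd φ w m * g (genuineCount w m) (w (m + 1)))]
    · rw [key]
      refine lintegral_congr fun w => ?_
      rw [lintegral_const_mul _ (hg _), hrec _ (w m), hstep _ (fun y =>
        φ (genuineCount w m + 1) y * G (genuineCount w m + 1) y) ((hφ _).mul (hG _))]
      simp only [g, ← hrec]
    · intro w
      by_cases h : (w (m + 1)).2.1 = Transition.dummy <;>
        simp [g, genuineProd, genuineCount, h, mul_assoc]

/-- Once `n` genuine transitions have occurred, `G` equals `1` and the running product is the full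
product. Everything is bounded by `1`, so dominated convergence carries the constant expectations of
`lintegral_genuineProd` to the limit. -/
lemma lintegral_prod_removeDummies (Ko Ku : Kernel Record Record) (hKo : IsMarkovKernel Ko)
    (hKu : IsMarkovKernel Ku)
    (hstep : ∀ (z : Record) (f : Record → ℝ≥0∞), Measurable f → ∫⁻ y, f y ∂Ko z =
      ∫⁻ y, (if y.2.1 = Transition.dummy then ∫⁻ y', f y' ∂Ko y else f y) ∂Ku z) (x : State)
    (hinf : ∀ᵐ w ∂recordLaw Ku hKu x, {k | IsGenuine w k}.Infinite)
    {φ : ℕ → Record → ℝ≥0∞} (hφ : ∀ i, Measurable (φ i)) (hle : ∀ i z, φ i z ≤ 1) {n : ℕ}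
    (hone : ∀ i, n < i → ∀ z, φ i z = 1) :
    ∫⁻ w, ∏ i ∈ Finset.range (n + 1), φ i (removeDummies w i) ∂recordLaw Ku hKu x =
      ∫⁻ w, ∏ i ∈ Finset.range (n + 1), φ i (w i) ∂recordLaw Ko hKo x := by
  obtain ⟨G, hGm, hGle, hGone, hrec⟩ := exists_backward_values Ko hφ hle hone
  have ho := lintegral_prod_recordLaw Ko hKo x hφ hGm hrec n
  simp only [hGone n le_rfl, mul_one] at ho
  rw [ho]
  have hu := lintegral_genuineProd Ko Ku hKu hstep x hφ hGm hrec
  have hlim : Filter.Tendsto (fun m => ∫⁻ w, genuineProd φ w m * G (genuineCount w m) (w m)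
      ∂recordLaw Ku hKu x) Filter.atTop
      (nhds (∫⁻ w, ∏ i ∈ Finset.range (n + 1), φ i (removeDummies w i) ∂recordLaw Ku hKu x)) := by
    refine tendsto_lintegral_of_dominated_convergence (fun _ => 1) (fun m => ?_) (fun m => ?_)
      (by simp) ?_
    · exact (measurable_genuineProd hφ m).mul ((measurable_uncurry_nat hGm).comp
        ((measurable_genuineCount m).prodMk (measurable_pi_apply m)))
    · refine Filter.Eventually.of_forall fun w => mul_le_one' ?_ (hGle _ _)
      rw [genuineProd_eq]
      exact Finset.prod_le_one' fun i _ => hle _ _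
    · filter_upwards [hinf] with w hw
      refine tendsto_const_nhds.congr' ?_
      filter_upwards [eventually_le_genuineCount hw n] with m hm
      rw [hGone _ hm, mul_one, genuineProd_eq]
      refine Finset.prod_subset (Finset.range_mono (by omega)) fun i _ hi => hone i ?_ _
      simpa using hi
  simp only [hu] at hlim
  exact tendsto_nhds_unique hlim tendsto_const_nhds

/-- Without its dummy transitions, the uniformized chain has the law of the original chain. -/
lemma map_removeDummies_recordLaw (Ko Ku : Kernel Record Record) (hKo : IsMarkovKernel Ko)
    (hKu : IsMarkovKernel Ku)
    (hstep : ∀ (z : Record) (f : Record → ℝ≥0∞), Measurable f → ∫⁻ y, f y ∂Ko z =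
      ∫⁻ y, (if y.2.1 = Transition.dummy then ∫⁻ y', f y' ∂Ko y else f y) ∂Ku z) (x : State)
    (hinf : ∀ᵐ w ∂recordLaw Ku hKu x, {k | IsGenuine w k}.Infinite) :
    (recordLaw Ku hKu x).map removeDummies = recordLaw Ko hKo x := by
  have := Measure.isProbabilityMeasure_map (μ := recordLaw Ku hKu x)
    measurable_removeDummies.aemeasurable
  refine ext_of_generate_finite _ generateFrom_squareCylinders.symm
    (isPiSystem_squareCylinders (fun _ => MeasurableSpace.isPiSystem_measurableSet)
      fun _ => MeasurableSet.univ (α := Record)) ?_ (by simp)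
  rintro _ ⟨s, t, ht, rfl⟩
  have ht : ∀ i, MeasurableSet (t i) := fun i => ht i (Set.mem_univ i)
  classical
  -- With these weights the product is the indicator of the cylinder; `s.sup id` bounds its indices.
  let φ : ℕ → Record → ℝ≥0∞ := fun i => if i ∈ s then (t i).indicator 1 else 1
  have hφ : ∀ i, Measurable (φ i) := by
    intro i
    by_cases hi : i ∈ s
    · simpa [φ, hi] using measurable_one.indicator (ht i)
    · simpa [φ, hi] using measurable_one
  have hle : ∀ i z, φ i z ≤ 1 := by
    intro i z
    by_cases hi : i ∈ s
    · simp only [φ, hi, if_true]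
      exact Set.indicator_le_self' (fun _ _ => zero_le_one) z
    · simp [φ, hi]
  have hprod : ∀ w : ℕ → Record, ∏ i ∈ Finset.range (s.sup id + 1), φ i (w i) =
      ((s : Set ℕ).pi t).indicator 1 w := by
    intro w
    have hsub : s ⊆ Finset.range (s.sup id + 1) := fun i hi =>
      Finset.mem_range_succ_iff.2 (Finset.le_sup (f := id) hi)
    rw [← Finset.prod_subset hsub fun i _ hi => by simp [φ, hi]]
    by_cases hw : w ∈ (s : Set ℕ).pi t
    · rw [Set.indicator_of_mem hw]
      exact Finset.prod_eq_one fun i hi => by simp [φ, hi, hw i hi]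
    · rw [Set.indicator_of_notMem hw]
      simp only [Set.mem_pi, not_forall] at hw
      obtain ⟨i, hi, hwi⟩ := hw
      exact Finset.prod_eq_zero (Finset.mem_coe.1 hi) (by simp [φ, Finset.mem_coe.1 hi, hwi])
  have key := lintegral_prod_removeDummies Ko Ku hKo hKu hstep x hinf hφ hle (n := s.sup id)
    fun i hi z => by
      have : i ∉ s := fun h => absurd (Finset.le_sup (f := id) h) (not_le.2 hi)
      simp [φ, this]
  have hm : MeasurableSet ((s : Set ℕ).pi t) := MeasurableSet.pi s.countable_toSet fun i _ => ht i
  simp only [hprod] at key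
  rw [lintegral_indicator_one hm] at key
  rw [Measure.map_apply measurable_removeDummies hm, ← key,
    ← lintegral_indicator_one (measurable_removeDummies hm)]
  rfl

/-! ### Almost sure properties of uniformized paths -/

/-- If a multiplicative functional contracts on average in each step, it vanishes in the limit. -/
lemma ae_tendsto_prod_zero (K : Kernel Record Record) (hK : IsMarkovKernel K) (x : State)
    {ψ : Record → Record → ℝ≥0∞} (hψ : Measurable (Function.uncurry ψ)) {q : ℝ≥0∞} (hq : q < 1)
    (h : ∀ z, ∫⁻ y, ψ z y ∂K z ≤ q) (m : ℕ) :
    ∀ᵐ w ∂recordLaw K hK x, Filter.Tendsto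
      (fun N => ∏ k ∈ Finset.range N, ψ (w (m + k)) (w (m + k + 1))) Filter.atTop (nhds 0) := by
  have hmeas : ∀ N, Measurable fun w : ℕ → Record =>
      ∏ k ∈ Finset.range N, ψ (w (m + k)) (w (m + k + 1)) := fun N =>
    Finset.measurable_prod _ fun k _ => hψ.comp (by fun_prop : Measurable fun w : ℕ → Record =>
      (w (m + k), w (m + k + 1)))
  have hpow : ∀ N, ∫⁻ w, ∏ k ∈ Finset.range N, ψ (w (m + k)) (w (m + k + 1)) ∂recordLaw K hK x
      ≤ q ^ N := by
    intro N
    induction N with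
    | zero => simp
    | succ N ih =>
      have hF : Measurable (Function.uncurry fun (w : ℕ → Record) (r : Record) =>
          (∏ k ∈ Finset.range N, ψ (w (m + k)) (w (m + k + 1))) * ψ (w (m + N)) r) :=
        ((hmeas N).comp measurable_fst).mul (hψ.comp (by fun_prop :
          Measurable fun z : (ℕ → Record) × Record => (z.1 (m + N), z.2)))
      have key := lintegral_recordLaw K hK x (m + N) hF fun w r => by
        congr 1
        · refine Finset.prod_congr rfl fun k hk => ?_
          have hk := Finset.mem_range.1 hk
          simp only [min_eq_left (by omega : m + k ≤ m + N),
            min_eq_left (by omega : m + k + 1 ≤ m + N)]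
        · simp only [min_self]
      simp only [Finset.prod_range_succ]
      rw [key, pow_succ]
      calc _ ≤ ∫⁻ w, (∏ k ∈ Finset.range N, ψ (w (m + k)) (w (m + k + 1))) * q
            ∂recordLaw K hK x := by
            refine lintegral_mono fun w => ?_
            have hw : Measurable (ψ (w (m + N))) := hψ.comp measurable_prodMk_left
            rw [lintegral_const_mul _ hw]
            exact mul_le_mul_right (h _) _
        _ ≤ _ := by
            rw [lintegral_mul_const _ (hmeas N)]
            exact mul_le_mul_left ih _
  -- The expectations are dominated by a geometric series, so almost surely the sum over `N` is
  -- finite and its terms tend to `0`.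
  have hsum : ∫⁻ w, ∑' N, ∏ k ∈ Finset.range N, ψ (w (m + k)) (w (m + k + 1))
      ∂recordLaw K hK x ≠ ∞ := by
    rw [lintegral_tsum fun N => (hmeas N).aemeasurable]
    refine ne_top_of_le_ne_top ?_ (ENNReal.tsum_le_tsum hpow)
    rw [ENNReal.tsum_geometric]
    exact ENNReal.inv_ne_top.2 (tsub_pos_of_lt hq).ne'
  filter_upwards [ae_lt_top (Measurable.tsum hmeas) hsum] with w hw
  exact ENNReal.tendsto_atTop_zero_of_tsum_ne_top hw.ne

/-- If all transitions after some index `m` were dummies, the product of dummy indicators from `m`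
on would stay `1`, yet it tends to `0` because each factor has conditional mean at most `q < 1`. -/
lemma Model.ae_infinite_genuine (M : Model) {B : ℝ} (hB : M.lam1 + M.lam2 + M.mu ≤ B)
    (p : Policy) (x : State) :
    ∀ᵐ w ∂M.uniformizedLaw B hB p x, {k | IsGenuine w k}.Infinite := by
  obtain ⟨q, hq, hle⟩ := M.exists_lintegral_dummy_le hB p
  have hψ : Measurable (Function.uncurry fun _ y : Record =>
      if y.2.1 = Transition.dummy then (1 : ℝ≥0∞) else 0) :=
    Measurable.ite (measurableSet_eq_fun (by fun_prop) measurable_const) measurable_const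
      measurable_const
  have hlim := ae_all_iff.2 fun m => ae_tendsto_prod_zero (M.uniformizedStep B hB p)
    (isMarkovKernel_stepKernel (fun _ => M.B_pos hB) _ _) x hψ hq hle m
  filter_upwards [hlim] with w hw hfin
  obtain ⟨m, hm⟩ := hfin.bddAbove
  refine zero_ne_one (tendsto_nhds_unique (hw m) (tendsto_const_nhds.congr fun N => ?_))
  refine (Finset.prod_eq_one fun k _ => ?_).symm
  have : ¬ IsGenuine w (m + k + 1) := fun h => by
    have : m + k + 1 ≤ m := hm h
    omega
  simp only [IsGenuine, not_or, not_not] at this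
  simp [this.2]

/-- The discount factors `exp (-(elapsed time))` contract on average by `B / (B + 1)`, so their
telescoping product tends to `0`; epochs bounded by `t` would keep it above `exp (-t)`. -/
lemma Model.ae_unbounded_epochs (M : Model) {B : ℝ} (hB : M.lam1 + M.lam2 + M.mu ≤ B)
    (p : Policy) (x : State) :
    ∀ᵐ w ∂M.uniformizedLaw B hB p x, ∀ t : ℝ≥0, ∃ n, t < (w n).1 := by
  have hB0 := M.B_pos hB
  have hψ : Measurable (Function.uncurry fun z y : Record =>
      ENNReal.ofReal (Real.exp ((z.1 : ℝ) - (y.1 : ℝ)))) := by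
    simp only [Function.uncurry_def]
    fun_prop
  have hq : ENNReal.ofReal (B / (B + 1)) < 1 := by
    rw [ENNReal.ofReal_lt_one, div_lt_one (by linarith)]
    linarith
  filter_upwards [ae_tendsto_prod_zero (M.uniformizedStep B hB p)
    (isMarkovKernel_stepKernel (fun _ => M.B_pos hB) _ _) x hψ hq
    (fun z => (M.lintegral_exp_uniformizedStep hB p z).le) 0] with w hw t
  by_contra! hle
  have hprod : ∀ N, ∏ k ∈ Finset.range N,
      ENNReal.ofReal (Real.exp (((w (0 + k)).1 : ℝ) - ((w (0 + k + 1)).1 : ℝ))) =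
      ENNReal.ofReal (Real.exp (((w 0).1 : ℝ) - ((w N).1 : ℝ))) := by
    intro N
    rw [← ENNReal.ofReal_prod_of_nonneg fun _ _ => (Real.exp_pos _).le, ← Real.exp_sum]
    simp only [zero_add]
    rw [Finset.sum_range_sub']
  simp only [hprod] at hw
  have : ENNReal.ofReal (Real.exp (-(t : ℝ))) ≤ 0 := ge_of_tendsto' hw fun N => by
    have h1 : ((w N).1 : ℝ) ≤ t := hle N
    have h2 : (0 : ℝ) ≤ (w 0).1 := NNReal.coe_nonneg _
    gcongr
    linarith
  rw [nonpos_iff_eq_zero, ENNReal.ofReal_eq_zero] at this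
  exact absurd (Real.exp_pos _) (not_lt.2 this)

open Classical in
lemma Model.ae_isStep (M : Model) {B : ℝ} (hB : M.lam1 + M.lam2 + M.mu ≤ B)
    (p : Policy) (x : State) :
    ∀ᵐ w ∂M.uniformizedLaw B hB p x, ∀ n, IsStep (w n) (w (n + 1)) := by
  refine ae_all_iff.2 fun n => ?_
  have hm : Measurable fun z : Record × Record => if IsStep z.1 z.2 then (0 : ℝ≥0∞) else 1 :=
    Measurable.ite measurableSet_isStep measurable_const measurable_const
  have hF : Measurable (Function.uncurry fun (w : ℕ → Record) (r : Record) =>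
      if IsStep (w n) r then (0 : ℝ≥0∞) else 1) :=
    hm.comp (by fun_prop : Measurable fun z : (ℕ → Record) × Record => (z.1 n, z.2))
  have key := lintegral_recordLaw (M.uniformizedStep B hB p)
    (isMarkovKernel_stepKernel (fun _ => M.B_pos hB) _ _) x n hF fun w r => by
      simp only [min_self]
  simp only [lintegral_not_isStep (fun _ => M.B_pos hB), lintegral_zero] at key
  have hm' : Measurable fun w : ℕ → Record => if IsStep (w n) (w (n + 1)) then (0 : ℝ≥0∞) else 1 :=
    hm.comp (by fun_prop : Measurable fun w : ℕ → Record => (w n, w (n + 1)))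
  rw [lintegral_eq_zero_iff hm'] at key
  filter_upwards [key] with w hw
  by_contra h
  simp [h] at hw

/-! ### Path functionals that do not see dummies -/

lemma lastEpoch_eq {w : ℕ → Record} (hw : Monotone fun n => (w n).1) {t : ℝ≥0} {N : ℕ}
    (h1 : (w N).1 ≤ t) (h2 : t < (w (N + 1)).1) : lastEpoch w t = N := by
  have : {n : ℕ | (w n).1 ≤ t} = Set.Iic N := by
    ext n
    refine ⟨fun h => ?_, fun h => (hw h).trans h1⟩
    by_contra hn
    exact absurd (h2.trans_le (hw (Nat.succ_le_of_lt (not_le.1 hn)))) (not_lt.2 h)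
  rw [lastEpoch, this, csSup_Iic]

lemma exists_epoch {w : ℕ → Record} (h0 : (w 0).1 = 0) (hunb : ∀ t : ℝ≥0, ∃ n, t < (w n).1)
    (t : ℝ≥0) : ∃ N, (w N).1 ≤ t ∧ t < (w (N + 1)).1 := by
  classical
  have hpos : Nat.find (hunb t) ≠ 0 := fun h => by
    have := Nat.find_spec (hunb t)
    rw [h, h0] at this
    exact not_lt_zero this
  obtain ⟨N, hN⟩ := Nat.exists_eq_succ_of_ne_zero hpos
  refine ⟨N, not_lt.1 (Nat.find_min (hunb t) (by omega)), ?_⟩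
  have := Nat.find_spec (hunb t)
  rwa [hN] at this

lemma drift_drift (x : State) (s u : ℝ≥0) : drift (drift x s) u = drift x (s + u) := by
  simp [drift, add_assoc]

lemma drift_zero (x : State) : drift x 0 = x := by
  simp [drift]

/-- Record number `genuineCount w k` of the thinned sequence is the latest genuine one up to `k`;
the dummies since then contribute drifts that add up. -/
lemma state_eq_drift_removeDummies {w : ℕ → Record} (hw : ∀ n, IsStep (w n) (w (n + 1)))
    (k : ℕ) : (removeDummies w (genuineCount w k)).1 ≤ (w k).1 ∧
      (w k).2.2 = drift (removeDummies w (genuineCount w k)).2.2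
        ((w k).1 - (removeDummies w (genuineCount w k)).1) := by
  induction k with
  | zero => simp [genuineCount, removeDummies_zero, drift_zero]
  | succ k ih =>
    by_cases h : (w (k + 1)).2.1 = Transition.dummy
    · obtain ⟨h1, h2⟩ := hw k
      rw [genuineCount, if_pos h]
      refine ⟨ih.1.trans h1, ?_⟩
      rw [h2 h, ih.2, drift_drift, add_comm, tsub_add_tsub_cancel h1 ih.1]
    · rw [removeDummies_genuineCount w (Or.inr h)]
      simp [drift_zero]

lemma stateAt_removeDummies {w : ℕ → Record} (h0 : (w 0).1 = 0)
    (hw : ∀ n, IsStep (w n) (w (n + 1))) (hinf : {k | IsGenuine w k}.Infinite)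
    (hunb : ∀ t : ℝ≥0, ∃ n, t < (w n).1) (t : ℝ≥0) :
    stateAt (removeDummies w) t = stateAt w t := by
  have hmono : Monotone fun n => (w n).1 := monotone_nat_of_le_succ fun n => (hw n).1
  have hmono' : Monotone fun n => (removeDummies w n).1 := fun a b hab =>
    hmono ((Nat.nth_monotone hinf) hab)
  obtain ⟨N, h1, h2⟩ := exists_epoch h0 hunb t
  obtain ⟨h3, h4⟩ := state_eq_drift_removeDummies hw N
  -- The next genuine transition has index at least `N + 1` in `w`, so it happens after `t`.
  have h5 : t < (removeDummies w (genuineCount w N + 1)).1 := by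
    refine h2.trans_le (hmono ?_)
    rw [← count_isGenuine]
    exact Nat.le_nth_count hinf _
  rw [stateAt, stateAt, lastEpoch_eq hmono h1 h2, lastEpoch_eq hmono' (h3.trans h1) h5, h4,
    drift_drift, add_comm, tsub_add_tsub_cancel h1 h3]

/-- `Nat.nth` enumerates the genuine indices injectively, and `g` vanishes at all others. -/
lemma tsum_removeDummies {w : ℕ → Record} (hinf : {k | IsGenuine w k}.Infinite)
    {g : Record → ℝ≥0∞} (hg : ∀ r : Record, r.2.1 = Transition.dummy → g r = 0) :
    ∑' n, g (removeDummies w n) = ∑' n, g (w n) := by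
  refine (Nat.nth_injective hinf).tsum_eq (f := fun n => g (w n)) fun n hn => ?_
  rw [Nat.range_nth_of_infinite hinf]
  exact Or.inr fun h => hn (hg _ h)

lemma countUpTo_removeDummies {w : ℕ → Record} (hinf : {k | IsGenuine w k}.Infinite)
    {a : Transition} (ha : a ≠ Transition.dummy) (t : ℝ≥0) :
    countUpTo (removeDummies w) a t = countUpTo w a t := by
  classical
  refine tsum_removeDummies hinf (g := fun r => if r.1 ≤ t ∧ r.2.1 = a then 1 else 0)
    fun r hr => if_neg fun h => ha (h.2.symm.trans hr)

lemma assignedUpTo_removeDummies {w : ℕ → Record} (hinf : {k | IsGenuine w k}.Infinite)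
    (t : ℝ≥0) : assignedUpTo (removeDummies w) t = assignedUpTo w t := by
  funext d
  cases d <;> exact countUpTo_removeDummies hinf (by simp) t

lemma Model.costUpTo_removeDummies (M : Model) {w : ℕ → Record} (h0 : (w 0).1 = 0)
    (hw : ∀ n, IsStep (w n) (w (n + 1))) (hinf : {k | IsGenuine w k}.Infinite)
    (hunb : ∀ t : ℝ≥0, ∃ n, t < (w n).1) (t : ℝ≥0) :
    M.costUpTo (removeDummies w) t = M.costUpTo w t := by
  classical
  rw [Model.costUpTo, Model.costUpTo]
  simp only [stateAt_removeDummies h0 hw hinf hunb]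
  congr 1
  refine tsum_removeDummies hinf (g := fun r => if r.1 ≤ t ∧ r.2.1 = Transition.dbAssign then
    ENNReal.ofReal ((r.2.2.2.2 : ℝ) - M.tol) else 0) fun r hr => if_neg fun h => ?_
  simp [hr] at h

/-! ### Measurability of the path functionals -/

/-- Turns the supremum of a path-dependent set into a countable supremum of measurable functions.
The identity holds for every path: if epochs accumulate, both sides take the default value `0`. -/
lemma lastEpoch_eq_iSup (w : ℕ → Record) (t : ℝ≥0) :
    lastEpoch w t = ⨆ n, if (w n).1 ≤ t then n else 0 := by
  let f : ℕ → ℕ := fun n => if (w n).1 ≤ t then n else 0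
  have hsub : {n : ℕ | (w n).1 ≤ t} ⊆ Set.range f := fun n hn => ⟨n, if_pos hn⟩
  change sSup {n : ℕ | (w n).1 ≤ t} = sSup (Set.range f)
  by_cases hb : BddAbove {n : ℕ | (w n).1 ≤ t}
  · have hle : ∀ n, f n ≤ sSup {n : ℕ | (w n).1 ≤ t} := by
      intro n
      by_cases h : (w n).1 ≤ t
      · simpa [f, h] using le_csSup hb h
      · simp [f, h]
    have hb' : BddAbove (Set.range f) := ⟨_, Set.forall_mem_range.2 hle⟩
    refine le_antisymm ?_ (csSup_le (Set.range_nonempty f) (Set.forall_mem_range.2 hle))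
    rcases Set.eq_empty_or_nonempty {n : ℕ | (w n).1 ≤ t} with he | he
    · simp [he]
    · exact csSup_le_csSup hb' he hsub
  · rw [Nat.sSup_of_not_bddAbove hb, Nat.sSup_of_not_bddAbove fun h => hb (h.mono hsub)]

lemma measurable_lastEpoch : Measurable fun z : (ℕ → Record) × ℝ≥0 => lastEpoch z.1 z.2 := by
  simp only [lastEpoch_eq_iSup]
  exact Measurable.iSup fun n => Measurable.ite (measurableSet_le (by fun_prop) measurable_snd)
    measurable_const measurable_const

lemma measurable_stateAt : Measurable fun z : (ℕ → Record) × ℝ≥0 => stateAt z.1 z.2 := by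
  have heval : Measurable fun z : ℕ × (ℕ → Record) => z.2 z.1 :=
    measurable_from_prod_countable_right fun k => measurable_pi_apply k
  have hlast : Measurable fun z : (ℕ → Record) × ℝ≥0 => z.1 (lastEpoch z.1 z.2) :=
    heval.comp (measurable_lastEpoch.prodMk measurable_fst)
  exact measurable_drift.comp ((measurable_snd.comp (measurable_snd.comp hlast)).prodMk
    (measurable_snd.sub (measurable_fst.comp hlast)))

lemma measurable_stateAt_apply (t : ℝ≥0) : Measurable fun w => stateAt w t :=
  measurable_stateAt.comp measurable_prodMk_right

lemma measurableSet_record_le (n : ℕ) (a : Transition) (t : ℝ≥0) :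
    MeasurableSet {w : ℕ → Record | (w n).1 ≤ t ∧ (w n).2.1 = a} :=
  (measurableSet_le (by fun_prop) measurable_const).inter
    (measurableSet_eq_fun (by fun_prop) measurable_const)

lemma measurable_countUpTo (a : Transition) (t : ℝ≥0) : Measurable fun w => countUpTo w a t :=
  Measurable.tsum fun n => Measurable.ite (measurableSet_record_le n a t) measurable_const
    measurable_const

lemma measurable_assignedUpTo (t : ℝ≥0) : Measurable fun w => assignedUpTo w t := by
  refine measurable_pi_iff.2 fun d => ?_
  cases d <;> exact measurable_countUpTo _ t

lemma Model.measurable_costUpTo (M : Model) (t : ℝ≥0) : Measurable fun w => M.costUpTo w t := by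
  refine Measurable.add ?_ (Measurable.tsum fun n =>
    Measurable.ite (measurableSet_record_le n _ t) (by fun_prop) measurable_const)
  have h : Measurable fun z : (ℕ → Record) × ℝ => ((stateAt z.1 z.2.toNNReal).1 : ℝ≥0∞) :=
    (measurable_of_countable fun i : ℕ => (i : ℝ≥0∞)).comp (measurable_fst.comp
      (measurable_stateAt.comp (measurable_fst.prodMk
        (measurable_real_toNNReal.comp measurable_snd))))
  exact h.lintegral_prod_right'

/-! ### Equality of the laws and of the costs -/

lemma Model.map_removeDummies_uniformizedLaw (M : Model) {B : ℝ}
    (hB : M.lam1 + M.lam2 + M.mu ≤ B) (p : Policy) (x : State) :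
    (M.uniformizedLaw B hB p x).map removeDummies = M.originalLaw p x :=
  map_removeDummies_recordLaw _ _ _ _
    (fun z _ hf => M.lintegral_originalStep_eq hB p z hf) x (M.ae_infinite_genuine hB p x)

/-- Path functionals that ignore the dummy transitions have the same law for both processes. -/
lemma Model.identDistrib_of_removeDummies (M : Model) {B : ℝ} (hB : M.lam1 + M.lam2 + M.mu ≤ B)
    (p : Policy) (x : State) {E : Type*} [MeasurableSpace E] {F : (ℕ → Record) → E}
    (hF : Measurable F)
    (h : ∀ᵐ w ∂M.uniformizedLaw B hB p x, F (removeDummies w) = F w) :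
    IdentDistrib F F (M.uniformizedLaw B hB p x) (M.originalLaw p x) where
  aemeasurable_fst := hF.aemeasurable
  aemeasurable_snd := hF.aemeasurable
  map_eq := by
    rw [← M.map_removeDummies_uniformizedLaw hB p x, Measure.map_map hF measurable_removeDummies]
    exact Measure.map_congr (h.mono fun w hw => hw.symm)

lemma Model.identDistrib_joint (M : Model) {B : ℝ} (hB : M.lam1 + M.lam2 + M.mu ≤ B)
    (p : Policy) (x : State) :
    IdentDistrib (fun (w : ℕ → Record) (t : ℝ≥0) =>
        (stateAt w t, assignedUpTo w t, M.costUpTo w t))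
      (fun (w : ℕ → Record) (t : ℝ≥0) => (stateAt w t, assignedUpTo w t, M.costUpTo w t))
      (M.uniformizedLaw B hB p x) (M.originalLaw p x) := by
  refine M.identDistrib_of_removeDummies hB p x (measurable_pi_iff.2 fun t =>
    (measurable_stateAt_apply t).prodMk
      ((measurable_assignedUpTo t).prodMk (M.measurable_costUpTo t))) ?_
  filter_upwards [ae_recordLaw_zero _ _ x, M.ae_isStep hB p x, M.ae_infinite_genuine hB p x,
    M.ae_unbounded_epochs hB p x] with w h0 hw hinf hunb
  have h0 : (w 0).1 = 0 := by rw [h0]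
  funext t
  rw [stateAt_removeDummies h0 hw hinf hunb, assignedUpTo_removeDummies hinf,
    M.costUpTo_removeDummies h0 hw hinf hunb]

lemma Model.expectedCost_uniformizedLaw (M : Model) {B : ℝ} (hB : M.lam1 + M.lam2 + M.mu ≤ B)
    (p : Policy) (x : State) (h : ℝ≥0) :
    M.expectedCost (M.uniformizedLaw B hB p x) h = M.expectedCost (M.originalLaw p x) h :=
  ((M.identDistrib_joint hB p x).comp (u := fun f : ℝ≥0 → State × (Action → ℝ≥0∞) × ℝ≥0∞ =>
    (f h).2.2) (by fun_prop)).lintegral_eq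

end QueryMDP

theorem theorem1 (M : QueryMDP.Model) (B : ℝ) (hB : M.lam1 + M.lam2 + M.mu ≤ B) :
    -- the two processes have the same law, as processes in continuous time
    (∀ (p : QueryMDP.Policy) (x : QueryMDP.State),
      IdentDistrib (fun (w : ℕ → QueryMDP.Record) (t : ℝ≥0) => QueryMDP.stateAt w t)
        (fun (w : ℕ → QueryMDP.Record) (t : ℝ≥0) => QueryMDP.stateAt w t)
        (M.uniformizedLaw B hB p x) (M.originalLaw p x)) ∧
    -- even jointly with the assignments made and the costs incurred
    (∀ (p : QueryMDP.Policy) (x : QueryMDP.State),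
      IdentDistrib
        (fun (w : ℕ → QueryMDP.Record) (t : ℝ≥0) =>
          (QueryMDP.stateAt w t, QueryMDP.assignedUpTo w t, M.costUpTo w t))
        (fun (w : ℕ → QueryMDP.Record) (t : ℝ≥0) =>
          (QueryMDP.stateAt w t, QueryMDP.assignedUpTo w t, M.costUpTo w t))
        (M.uniformizedLaw B hB p x) (M.originalLaw p x)) ∧
    -- the expected costs agree
    (∀ (p : QueryMDP.Policy) (x : QueryMDP.State),
      (∀ h : ℝ≥0, M.expectedCost (M.uniformizedLaw B hB p x) h
        = M.expectedCost (M.originalLaw p x) h) ∧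
      M.averageCost (M.uniformizedLaw B hB p x) = M.averageCost (M.originalLaw p x)) ∧
    -- the optimal policies agree
    (∀ x : QueryMDP.State,
      (∀ h : ℝ≥0,
        QueryMDP.optimalPolicies (fun p => M.expectedCost (M.uniformizedLaw B hB p x) h)
          = QueryMDP.optimalPolicies (fun p => M.expectedCost (M.originalLaw p x) h)) ∧
      QueryMDP.optimalPolicies (fun p => M.averageCost (M.uniformizedLaw B hB p x))
        = QueryMDP.optimalPolicies (fun p => M.averageCost (M.originalLaw p x))) := by
  have hcost := fun p x h => M.expectedCost_uniformizedLaw hB p x h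
  have havg : ∀ p x, M.averageCost (M.uniformizedLaw B hB p x) =
      M.averageCost (M.originalLaw p x) := fun p x => by
    simp only [QueryMDP.Model.averageCost, hcost]
  refine ⟨fun p x => ?_, fun p x => M.identDistrib_joint hB p x,
    fun p x => ⟨hcost p x, havg p x⟩, fun x => ⟨fun h => ?_, ?_⟩⟩
  · exact (M.identDistrib_joint hB p x).comp (u := fun (f : ℝ≥0 → QueryMDP.State ×
      (QueryMDP.Action → ℝ≥0∞) × ℝ≥0∞) t => (f t).1) (by fun_prop)
  · simp only [hcost]
  · simp only [havg]
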